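/- Let $d\ge 1$ and let $F\subset E\subset L=\prod_{l\in\mathbb Z/d}L_l$ be ring extensions, where $F$, $E$ and all $L_l$ are fields. Let $\sigma:L\to L$ be a ring endomorphism such that $\sigma(E)\subset E$, $\sigma(L_l)\subset L_{l+1}$ for all $l$, $F=E^{\sigma}=L^{\sigma}$, and $L$ is separable over $E$. Let $r\ge 1$, $\Phi\in \mathrm{GL}_r(E)$ and $\Psi\in\mathrm{GL}_r(L)$ satisfy $\sigma(\Psi)=\Phi\Psi$ ($\sigma$ applied entrywise), and let $\Psi_l\in\mathrm{GL}_r(L_l)$ be the $l$-th component of $\Psi$. Let $X=(X_{ij})$ be an $r\times r$ matrix of variables and $\Delta=\det X$. Define closed subschemes of $\mathrm{GL}_{r/E}=\operatorname{Spec}E[X,\Delta^{-1}]$ by $$Z=\operatorname{Spec}E[X,\Delta^{-1}]/\mathfrak p,\qquad Z_l=\operatorname{Spec}E[X,\Delta^{-1}]/\mathfrak p_l ,$$ where $\mathfrak p$ and $\mathfrak p_l$ are the kernels of the $E$-algebra homomorphisms $E[X,\Delta^{-1}]\to L$, $X\mapsto\Psi$, and $E[X,\Delta^{-1}]\to L_l$,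 $X\mapsto\Psi_l$; thus $Z\cong\operatorname{Spec}\Sigma$ with $\Sigma=E[\Psi,\det(\Psi)^{-1}]\subset L$. Define closed subschemes of $\mathrm{GL}_{r/F}=\operatorname{Spec}F[X,\Delta^{-1}]$ by $$\Gamma=\operatorname{Spec}F[X,\Delta^{-1}]/\mathfrak q,\qquad \Gamma_m=\operatorname{Spec}F[X,\Delta^{-1}]/\mathfrak q_m\quad(m\in\mathbb Z/d),$$ where $\mathfrak q$ is the kernel of the $F$-algebra homomorphism $F[X,\Delta^{-1}]\to L\otimes_E L$, $X\mapsto(\Psi\otimes1)^{-1}(1\otimes\Psi)$, and $\mathfrak q_m$ is the kernel of $F[X,\Delta^{-1}]\to L_0\otimes_E L_m$, $X\mapsto(\Psi_0\otimes1)^{-1}(1\otimes\Psi_m)$. Write $\Gamma_E$ and $\Gamma_{0,E}$ for the base changes of $\Gamma$ and $\Gamma_0$ from $F$ to $E$. Then: 1. $\Gamma$ is a closed $F$-subgroup scheme of $\mathrm{GL}_{r/F}$; the $E$-scheme $Z$ is stable under right multiplication by $\Gamma_E$ and is a $\Gamma_E$-torsor. 2. $\Gamma_0$ is a closed $F$-subgroup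 scheme of $\mathrm{GL}_{r/F}$; for each $l\in\mathbb Z/d$ the $E$-scheme $Z_l$ is stable under right multiplication by $\Gamma_{0,E}$ and is a $\Gamma_{0,E}$-torsor. 3. For each $m\in\mathbb Z/d$ the $F$-scheme $\Gamma_m$ is stable under right and under left multiplication by $\Gamma_0$ and is a $\Gamma_0$-torsor (for either action). Here a scheme $Y$ over a field $k$ with an action of a $k$-group scheme $G$ is a $G$-torsor if $Y\to\operatorname{Spec}k$ is flat, surjective and locally of finite presentation, and the morphism from the product of $Y$ and $G$ to $Y\times_k Y$ that sends a point and a group element to the point together with its translate is an isomorphism. -/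

import Mathlib

open CategoryTheory MonoidalCategory CartesianMonoidalCategory AlgebraicGeometry
open scoped TensorProduct MatrixGroups

universe u v w

noncomputable section

namespace FrobeniusTorsor

/-! ### The group scheme `GL_r` -/

section GeneralLinear

variable (r : ℕ) (R : Type u) [CommRing R]

/-- `R[X, Δ⁻¹]`: polynomials in the entries `X i j` of an `r × r` matrix, with the determinant
`Δ = det X` inverted. -/
abbrev GLCoord : Type u :=
  Localization.Away (Matrix.mvPolynomialX (Fin r) (Fin r) R).det

/-- The matrix `X` of variables, as an invertible matrix over `R[X, Δ⁻¹]`. -/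
def genericMatrix : GL (Fin r) (GLCoord r R) :=
  Matrix.GeneralLinearGroup.mk''
    ((Matrix.mvPolynomialX (Fin r) (Fin r) R).map
      (algebraMap (MvPolynomial (Fin r × Fin r) R) (GLCoord r R)))
    (by
      rw [← RingHom.mapMatrix_apply, ← RingHom.map_det]
      exact IsLocalization.Away.algebraMap_isUnit _)

variable {r}
variable {A : Type v} [CommRing A] [Algebra R A] {B : Type w} [CommRing B] [Algebra R B]

/-- The `R`-algebra homomorphism `R[X, Δ⁻¹] → A` with `X ↦ M`. -/
def evalGL (M : GL (Fin r) A) : GLCoord r R →ₐ[R] A :=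
  IsLocalization.Away.liftAlgHom (Matrix.mvPolynomialX (Fin r) (Fin r) R).det
    (f := MvPolynomial.aeval fun p : Fin r × Fin r => M.1 p.1 p.2)
    (by
      rw [AlgHom.map_det]
      have : (MvPolynomial.aeval fun p : Fin r × Fin r => M.1 p.1 p.2).mapMatrix
          (Matrix.mvPolynomialX (Fin r) (Fin r) R) = M.1 := by
        ext i j; simp [Matrix.mvPolynomialX]
      rw [this]
      exact (Matrix.isUnit_iff_isUnit_det _).1 M.isUnit)

/-- The image of an invertible matrix under a homomorphism of `R`-algebras. -/
abbrev mapGL (f : A →ₐ[R] B) : GL (Fin r) A →* GL (Fin r) B :=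
  Matrix.GeneralLinearGroup.map f.toRingHom

variable {R}

theorem mapGL_apply (f : A →ₐ[R] B) (M : GL (Fin r) A) (i j : Fin r) :
    (mapGL R f M).1 i j = f (M.1 i j) := rfl

theorem genericMatrix_apply (i j : Fin r) :
    (genericMatrix r R).1 i j =
      algebraMap (MvPolynomial (Fin r × Fin r) R) (GLCoord r R) (MvPolynomial.X (i, j)) := rfl

theorem evalGL_genericMatrix (M : GL (Fin r) A) :
    mapGL R (evalGL R M) (genericMatrix r R) = M := by
  ext i j
  rw [mapGL_apply, genericMatrix_apply, evalGL, IsLocalization.Away.liftAlgHom_apply,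
    IsLocalization.Away.lift_eq]
  simp

theorem algHom_ext_GL {f g : GLCoord r R →ₐ[R] A}
    (h : mapGL R f (genericMatrix r R) = mapGL R g (genericMatrix r R)) : f = g := by
  apply IsLocalization.algHom_ext
    (Submonoid.powers (Matrix.mvPolynomialX (Fin r) (Fin r) R).det)
  apply MvPolynomial.algHom_ext
  rintro ⟨i, j⟩
  have h' : (mapGL R f (genericMatrix r R)).1 i j = (mapGL R g (genericMatrix r R)).1 i j := by
    rw [h]
  exact h'

theorem mapGL_comp (g : A →ₐ[R] B) (f : GLCoord r R →ₐ[R] A) (M : GL (Fin r) (GLCoord r R)) :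
    mapGL R (g.comp f) M = mapGL R g (mapGL R f M) := by
  ext i j; rfl

theorem comp_evalGL (g : A →ₐ[R] B) (M : GL (Fin r) A) :
    g.comp (evalGL R M) = evalGL R (mapGL R g M) := by
  apply algHom_ext_GL
  rw [mapGL_comp, evalGL_genericMatrix, evalGL_genericMatrix]

theorem evalGL_eq_of {f : GLCoord r R →ₐ[R] A} {M : GL (Fin r) A}
    (h : mapGL R f (genericMatrix r R) = M) : evalGL R M = f :=
  algHom_ext_GL (by rw [evalGL_genericMatrix, h])

theorem mapGL_mapGL {C : Type*} [CommRing C] [Algebra R C] (g : B →ₐ[R] C) (f : A →ₐ[R] B)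
    (M : GL (Fin r) A) : mapGL R g (mapGL R f M) = mapGL R (g.comp f) M := by
  ext i j; rfl

variable (r R)

/-- The comultiplication `X ↦ (X ⊗ 1) (1 ⊗ X)` of `R[X, Δ⁻¹]`. -/
def comulGL : GLCoord r R →ₐ[R] GLCoord r R ⊗[R] GLCoord r R :=
  evalGL R (mapGL R Algebra.TensorProduct.includeLeft (genericMatrix r R) *
    mapGL R Algebra.TensorProduct.includeRight (genericMatrix r R))

/-- The counit `X ↦ 1` of `R[X, Δ⁻¹]`. -/
def counitGL : GLCoord r R →ₐ[R] R := evalGL R 1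

/-- The antipode `X ↦ X⁻¹` of `R[X, Δ⁻¹]`. -/
def antipodeGL : GLCoord r R →ₐ[R] GLCoord r R := evalGL R (genericMatrix r R)⁻¹


theorem mapGL_comulGL (g : GLCoord r R ⊗[R] GLCoord r R →ₐ[R] A) :
    g.comp (comulGL r R) = evalGL R
      (mapGL R (g.comp Algebra.TensorProduct.includeLeft) (genericMatrix r R) *
        mapGL R (g.comp Algebra.TensorProduct.includeRight) (genericMatrix r R)) := by
  rw [comulGL, comp_evalGL, map_mul, mapGL_mapGL, mapGL_mapGL]

theorem comulGL_coassoc :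
    (Algebra.TensorProduct.assoc R R R (GLCoord r R) (GLCoord r R) (GLCoord r R)).toAlgHom.comp
      ((Algebra.TensorProduct.map (comulGL r R) (.id R (GLCoord r R))).comp (comulGL r R)) =
      (Algebra.TensorProduct.map (.id R (GLCoord r R)) (comulGL r R)).comp (comulGL r R) := by
  let A₃ := GLCoord r R ⊗[R] (GLCoord r R ⊗[R] GLCoord r R)
  let i₁ : GLCoord r R →ₐ[R] A₃ := Algebra.TensorProduct.includeLeft
  let i₂ : GLCoord r R →ₐ[R] A₃ :=
    (Algebra.TensorProduct.includeRight : _ →ₐ[R] A₃).comp Algebra.TensorProduct.includeLeft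
  let i₃ : GLCoord r R →ₐ[R] A₃ :=
    (Algebra.TensorProduct.includeRight : _ →ₐ[R] A₃).comp Algebra.TensorProduct.includeRight
  let as := (Algebra.TensorProduct.assoc R R R (GLCoord r R) (GLCoord r R) (GLCoord r R)).toAlgHom
  have h1 : (as.comp (Algebra.TensorProduct.map (comulGL r R) (.id R (GLCoord r R)))).comp
      Algebra.TensorProduct.includeLeft =
      (as.comp Algebra.TensorProduct.includeLeft).comp (comulGL r R) := by
    ext x; simp
  have h2 : (as.comp (Algebra.TensorProduct.map (comulGL r R) (.id R (GLCoord r R)))).comp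
      Algebra.TensorProduct.includeRight = i₃ := by
    apply AlgHom.ext; intro x; simp [as, i₃, Algebra.TensorProduct.one_def]
  have h3 : (Algebra.TensorProduct.map (.id R (GLCoord r R)) (comulGL r R)).comp
      Algebra.TensorProduct.includeLeft = i₁ := by
    apply AlgHom.ext; intro x; simp [i₁]
  have h4 : (Algebra.TensorProduct.map (.id R (GLCoord r R)) (comulGL r R)).comp
      Algebra.TensorProduct.includeRight =
      (Algebra.TensorProduct.includeRight : _ →ₐ[R] A₃).comp (comulGL r R) := by
    apply AlgHom.ext; intro x; simp
  have h5 : (as.comp Algebra.TensorProduct.includeLeft).comp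
      (Algebra.TensorProduct.includeLeft : GLCoord r R →ₐ[R] _) = i₁ := by
    apply AlgHom.ext; intro x; simp [as, i₁, Algebra.TensorProduct.one_def]
  have h6 : (as.comp Algebra.TensorProduct.includeLeft).comp
      (Algebra.TensorProduct.includeRight : GLCoord r R →ₐ[R] _) = i₂ := by
    apply AlgHom.ext; intro x; simp [as, i₂]
  have e1 := mapGL_comulGL r R (A := A₃)
    (as.comp (Algebra.TensorProduct.map (comulGL r R) (.id R (GLCoord r R))))
  have e2 := mapGL_comulGL r R (A := A₃)
    (Algebra.TensorProduct.map (.id R (GLCoord r R)) (comulGL r R))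
  have e3 := mapGL_comulGL r R (A := A₃) (as.comp Algebra.TensorProduct.includeLeft)
  have e4 := mapGL_comulGL r R (A := A₃) Algebra.TensorProduct.includeRight
  refine e1.trans (Eq.trans ?_ e2.symm)
  rw [h1, h2, h3, h4, e3, e4, evalGL_genericMatrix, evalGL_genericMatrix, h5, h6, mul_assoc]

theorem comulGL_rTensor :
    (Algebra.TensorProduct.map (counitGL r R) (.id R (GLCoord r R))).comp (comulGL r R) =
      (Algebra.TensorProduct.lid R (GLCoord r R)).symm := by
  have h1 : (Algebra.TensorProduct.map (counitGL r R) (.id R (GLCoord r R))).comp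
      Algebra.TensorProduct.includeLeft =
      (Algebra.TensorProduct.includeLeft : R →ₐ[R] R ⊗[R] GLCoord r R).comp (counitGL r R) := by
    apply AlgHom.ext; intro x; simp
  rw [mapGL_comulGL, h1, counitGL, comp_evalGL, evalGL_genericMatrix, map_one, one_mul]
  apply evalGL_eq_of
  ext i j
  rw [mapGL_apply, mapGL_apply]
  simp

theorem comulGL_lTensor :
    (Algebra.TensorProduct.map (.id R (GLCoord r R)) (counitGL r R)).comp (comulGL r R) =
      (Algebra.TensorProduct.rid R R (GLCoord r R)).symm := by
  have h1 : (Algebra.TensorProduct.map (.id R (GLCoord r R)) (counitGL r R)).comp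
      Algebra.TensorProduct.includeRight =
      (Algebra.TensorProduct.includeRight : R →ₐ[R] GLCoord r R ⊗[R] R).comp (counitGL r R) := by
    apply AlgHom.ext; intro x; simp
  rw [mapGL_comulGL, h1, counitGL, comp_evalGL, evalGL_genericMatrix, map_one, mul_one]
  apply evalGL_eq_of
  ext i j
  rw [mapGL_apply, mapGL_apply]
  simp

/-- The bialgebra structure of `R[X, Δ⁻¹]` that corresponds to multiplication of matrices. -/
instance instBialgebraGLCoord : Bialgebra R (GLCoord r R) :=
  Bialgebra.ofAlgHom (comulGL r R) (counitGL r R) (comulGL_coassoc r R) (comulGL_rTensor r R)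
    (comulGL_lTensor r R)

/-- The Hopf algebra structure of `R[X, Δ⁻¹]`. -/
instance instHopfAlgebraGLCoord : HopfAlgebra R (GLCoord r R) where
  antipode := (antipodeGL r R).toLinearMap
  mul_antipode_rTensor_comul := by
    have h : ((Algebra.TensorProduct.lmul' R (S := GLCoord r R)).comp
        (Algebra.TensorProduct.map (antipodeGL r R) (.id R (GLCoord r R)))).comp (comulGL r R) =
        (Algebra.ofId R (GLCoord r R)).comp (counitGL r R) := by
      have h1 : ((Algebra.TensorProduct.lmul' R (S := GLCoord r R)).comp
        (Algebra.TensorProduct.map (antipodeGL r R) (.id R (GLCoord r R)))).comp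
        Algebra.TensorProduct.includeLeft = antipodeGL r R := by
        apply AlgHom.ext; intro x; simp
      have h2 : ((Algebra.TensorProduct.lmul' R (S := GLCoord r R)).comp
        (Algebra.TensorProduct.map (antipodeGL r R) (.id R (GLCoord r R)))).comp
        Algebra.TensorProduct.includeRight = .id R _ := by
        apply AlgHom.ext; intro x; simp
      have h3 : mapGL R (.id R (GLCoord r R)) (genericMatrix r R) = genericMatrix r R := by
        ext i j; rfl
      rw [mapGL_comulGL, h1, h2, h3, antipodeGL, evalGL_genericMatrix, inv_mul_cancel, counitGL,
        comp_evalGL, map_one]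
    exact congrArg AlgHom.toLinearMap h
  mul_antipode_lTensor_comul := by
    have h : ((Algebra.TensorProduct.lmul' R (S := GLCoord r R)).comp
        (Algebra.TensorProduct.map (.id R (GLCoord r R)) (antipodeGL r R))).comp (comulGL r R) =
        (Algebra.ofId R (GLCoord r R)).comp (counitGL r R) := by
      have h1 : ((Algebra.TensorProduct.lmul' R (S := GLCoord r R)).comp
        (Algebra.TensorProduct.map (.id R (GLCoord r R)) (antipodeGL r R))).comp
        Algebra.TensorProduct.includeRight = antipodeGL r R := by
        apply AlgHom.ext; intro x; simp
      have h2 : ((Algebra.TensorProduct.lmul' R (S := GLCoord r R)).comp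
        (Algebra.TensorProduct.map (.id R (GLCoord r R)) (antipodeGL r R))).comp
        Algebra.TensorProduct.includeLeft = .id R _ := by
        apply AlgHom.ext; intro x; simp
      have h3 : mapGL R (.id R (GLCoord r R)) (genericMatrix r R) = genericMatrix r R := by
        ext i j; rfl
      rw [mapGL_comulGL, h1, h2, h3, antipodeGL, evalGL_genericMatrix, mul_inv_cancel, counitGL,
        comp_evalGL, map_one]
    exact congrArg AlgHom.toLinearMap h

end GeneralLinear

section Schemes

/-- `Spec A` as a scheme over `Spec R`, for an `R`-algebra `A`. -/
abbrev specOver (R A : Type u) [CommRing R] [CommRing A] [Algebra R A] :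
    Over (Spec (CommRingCat.of R)) :=
  Over.mk (Spec.map (CommRingCat.ofHom (algebraMap R A)))

/-- The scheme `GL_{r/R}`. -/
abbrev GLScheme (r : ℕ) (R : Type u) [CommRing R] : Over (Spec (CommRingCat.of R)) :=
  specOver R (GLCoord r R)

/-- The group scheme structure of `GL_{r/R}` given by multiplication of matrices. -/
instance instGrpObjGLScheme (r : ℕ) (R : Type u) [CommRing R] : GrpObj (GLScheme r R) :=
  inferInstanceAs (GrpObj
    ((Spec (CommRingCat.of (GLCoord r R))).asOver (Spec (CommRingCat.of R))))

variable {r : ℕ} {R : Type u} [CommRing R]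

/-- The closed subscheme `Spec (R[X, Δ⁻¹] / I)` of `GL_{r/R}`. -/
abbrev closedSub (I : Ideal (GLCoord r R)) : Over (Spec (CommRingCat.of R)) :=
  specOver R (GLCoord r R ⧸ I)

/-- The inclusion of `Spec (R[X, Δ⁻¹] / I)` into `GL_{r/R}`. -/
def closedSubι (I : Ideal (GLCoord r R)) : closedSub I ⟶ GLScheme r R :=
  Over.homMk (Spec.map (CommRingCat.ofHom (Ideal.Quotient.mk I))) (by
    simp only [Over.mk_hom, ← Spec.map_comp, ← CommRingCat.ofHom_comp])

/-- Base change `Y ↦ Y ×_{Spec R} Spec S` from schemes over `R` to schemes over `S`. -/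
abbrev baseChange (R S : Type u) [CommRing R] [CommRing S] [Algebra R S] :
    Over (Spec (CommRingCat.of R)) ⥤ Over (Spec (CommRingCat.of S)) :=
  Over.pullback (Spec.map (CommRingCat.ofHom (algebraMap R S)))

/-- The base change of a group scheme is a group scheme. -/
instance instGrpObjBaseChange (S : Type u) [CommRing S] [Algebra R S]
    (G : Over (Spec (CommRingCat.of R))) [GrpObj G] : GrpObj ((baseChange R S).obj G) :=
  Functor.grpObjObj

/-- The square formed by `GL_{r/S}`, `GL_{r/R}`, `Spec S` and `Spec R` is cartesian. -/
theorem isPullback_GL (r : ℕ) (R S : Type u) [CommRing R] [CommRing S] [Algebra R S] :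
    IsPullback (Spec.map (CommRingCat.ofHom (evalGL R (genericMatrix r S)).toRingHom))
      (Spec.map (CommRingCat.ofHom (algebraMap S (GLCoord r S))))
      (Spec.map (CommRingCat.ofHom (algebraMap R (GLCoord r R))))
      (Spec.map (CommRingCat.ofHom (algebraMap R S))) := by
  apply isPullback_SpecMap_of_isPushout
  have w : CommRingCat.ofHom (algebraMap R (GLCoord r R)) ≫
      CommRingCat.ofHom (evalGL R (genericMatrix r S)).toRingHom =
      CommRingCat.ofHom (algebraMap R S) ≫ CommRingCat.ofHom (algebraMap S (GLCoord r S)) := by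
    ext x
    simp [← IsScalarTower.algebraMap_apply]
  refine ⟨⟨w⟩, ⟨Limits.PushoutCocone.IsColimit.mk w
    (fun s => ?_) (fun s => ?_) (fun s => ?_) (fun s m h1 h2 => ?_)⟩⟩
  · letI : Algebra S s.pt := s.inr.hom.toAlgebra
    exact CommRingCat.ofHom
      (evalGL S (Matrix.GeneralLinearGroup.map s.inl.hom (genericMatrix r R))).toRingHom
  · let : Algebra S s.pt := s.inr.hom.toAlgebra
    let : Algebra R s.pt := (s.inr.hom.comp (algebraMap R S)).toAlgebra
    have : IsScalarTower R S s.pt := IsScalarTower.of_algebraMap_eq' rfl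
    let f : GLCoord r R →ₐ[R] s.pt :=
      { s.inl.hom with
        commutes' := fun x => congrArg (fun φ => φ.hom x) s.condition }
    have : ((evalGL S (mapGL R f (genericMatrix r R))).restrictScalars R).comp
        (evalGL R (genericMatrix r S)) = f := by
      rw [comp_evalGL]
      exact evalGL_eq_of (evalGL_genericMatrix (R := S) (mapGL R f (genericMatrix r R))).symm
    ext x
    exact DFunLike.congr_fun this x
  · let : Algebra S s.pt := s.inr.hom.toAlgebra
    ext x
    exact (evalGL S (Matrix.GeneralLinearGroup.map s.inl.hom (genericMatrix r R))).commutes x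
  · let : Algebra S s.pt := s.inr.hom.toAlgebra
    let m' : GLCoord r S →ₐ[S] s.pt :=
      { m.hom with commutes' := fun x => congrArg (fun φ => φ.hom x) h2 }
    have : evalGL S (Matrix.GeneralLinearGroup.map s.inl.hom (genericMatrix r R)) = m' := by
      apply evalGL_eq_of
      rw [← h1]
      ext i j
      change m.hom _ = m.hom ((mapGL R (evalGL R (genericMatrix r S)) (genericMatrix r R)).1 i j)
      rw [evalGL_genericMatrix]
    ext x
    exact (DFunLike.congr_fun this x).symm

/-- The canonical morphism `GL_{r/S} ⟶ GL_{r/R} ×_R S`. -/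
def GLToBaseChange (r : ℕ) (R S : Type u) [CommRing R] [CommRing S] [Algebra R S] :
    GLScheme r S ⟶ (baseChange R S).obj (GLScheme r R) :=
  Over.homMk (Limits.pullback.lift
      (Spec.map (CommRingCat.ofHom (evalGL R (genericMatrix r S)).toRingHom))
      (Spec.map (CommRingCat.ofHom (algebraMap S (GLCoord r S)))) (isPullback_GL r R S).w)
    (Limits.pullback.lift_snd _ _ _)

/-- The canonical morphism `GL_{r/S} ⟶ GL_{r/R} ×_R S` is an isomorphism. -/
theorem isIso_GLToBaseChange (r : ℕ) (R S : Type u) [CommRing R] [CommRing S] [Algebra R S] :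
    IsIso (GLToBaseChange r R S) := by
  have h : (GLToBaseChange r R S).left = (isPullback_GL r R S).isoPullback.hom := by
    apply Limits.pullback.hom_ext
    · exact (Limits.pullback.lift_fst _ _ _).trans (IsPullback.isoPullback_hom_fst _).symm
    · exact (Limits.pullback.lift_snd _ _ _).trans (IsPullback.isoPullback_hom_snd _).symm
  have : IsIso ((Over.forget _).map (GLToBaseChange r R S)) := by
    rw [Over.forget_map, h]; exact Iso.isIso_hom _
  exact isIso_of_reflects_iso _ (Over.forget _)

theorem evalGL_comp_restrict (r : ℕ) (R S : Type u) [CommRing R] [CommRing S] [Algebra R S]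
    {B : Type u} [CommRing B] [Algebra R B] [Algebra S B] [IsScalarTower R S B]
    (M : GL (Fin r) B) :
    ((evalGL S M).restrictScalars R).comp (evalGL R (genericMatrix r S)) = evalGL R M := by
  rw [comp_evalGL]
  congr 1
  exact evalGL_genericMatrix (R := S) M

open Limits in
/-- The canonical isomorphism `GL_{r/S} ⟶ GL_{r/R} ×_R S` respects multiplication. -/
theorem isMonHom_GLToBaseChange (r : ℕ) (R S : Type u) [CommRing R] [CommRing S] [Algebra R S] :
    IsMonHom (GLToBaseChange r R S) where
  one_hom := by
    ext1
    apply pullback.hom_ext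
    · have h1 : (MonObj.one (X := (baseChange R S).obj (GLScheme r R))).left ≫ pullback.fst _ _ =
          Spec.map (CommRingCat.ofHom (algebraMap R S)) ≫ (MonObj.one (X := GLScheme r R)).left := by
        change ((Functor.LaxMonoidal.ε (baseChange R S)) ≫
          (baseChange R S).map (MonObj.one (X := GLScheme r R))).left ≫ _ = _
        rw [Over.comp_left, Over.ε_pullback_left, Category.assoc, IsIso.inv_comp_eq]
        refine (pullback.lift_fst _ _ _).trans ?_
        have := pullback.condition (f := (𝟙_ (Over (Spec (CommRingCat.of R)))).hom) (g := Spec.map (CommRingCat.ofHom (algebraMap R S)))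
        rw [← Category.assoc]
        congr 1
      refine Eq.trans ?_ h1.symm
      rw [Over.comp_left, Category.assoc]
      have : (GLToBaseChange r R S).left ≫ pullback.fst _ _ = 
        Spec.map (CommRingCat.ofHom (evalGL R (genericMatrix r S)).toRingHom) := pullback.lift_fst _ _ _
      refine (congrArg _ this).trans ?_
      refine (Spec.map_comp _ _).symm.trans (Eq.trans ?_ (Spec.map_comp _ _))
      congr 1
      have := evalGL_comp_restrict r R S (1 : GL (Fin r) S)
      have h2 : (Algebra.ofId R S).comp (counitGL r R) = evalGL R 1 := by
        rw [counitGL, comp_evalGL, map_one]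
      ext x
      exact DFunLike.congr_fun (this.trans h2.symm) x
    · exact (Over.w _).trans (Over.w _).symm
  mul_hom := by
    ext1
    apply pullback.hom_ext
    · have hb : ((baseChange R S).map (MonObj.mul (X := GLScheme r R))).left ≫ pullback.fst _ _ =
         pullback.fst _ _ ≫ (MonObj.mul (X := GLScheme r R)).left := pullback.lift_fst _ _ _
      have hc : (GLToBaseChange r R S).left ≫ pullback.fst _ _ = 
        Spec.map (CommRingCat.ofHom (evalGL R (genericMatrix r S)).toRingHom) := pullback.lift_fst _ _ _
      rw [Over.comp_left, Over.comp_left, Category.assoc, Category.assoc]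
      have hm : (MonObj.mul (X := (baseChange R S).obj (GLScheme r R))).left ≫ pullback.fst _ _ =
          (Functor.LaxMonoidal.μ (baseChange R S) (GLScheme r R) (GLScheme r R)).left ≫
            pullback.fst _ _ ≫ (MonObj.mul (X := GLScheme r R)).left := by
        rw [← hb, ← Category.assoc, ← Over.comp_left]
        rfl
      refine (congrArg _ hc).trans (Eq.trans ?_ (congrArg
        (fun t => (GLToBaseChange r R S ⊗ₘ GLToBaseChange r R S).left ≫ t) hm).symm)
      rw [← cancel_epi (pullbackSpecIso S (GLCoord r S) (GLCoord r S)).inv]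
      let i : GLCoord r R ⊗[R] GLCoord r R →ₐ[R] GLCoord r S ⊗[S] GLCoord r S :=
        Algebra.TensorProduct.lift
          (((Algebra.TensorProduct.includeLeft : GLCoord r S →ₐ[S] GLCoord r S ⊗[S] GLCoord r S).restrictScalars R).comp (evalGL R (genericMatrix r S)))
          (((Algebra.TensorProduct.includeRight : GLCoord r S →ₐ[S] GLCoord r S ⊗[S] GLCoord r S).restrictScalars R).comp (evalGL R (genericMatrix r S)))
          fun _ _ => Commute.all _ _
      have key : (pullbackSpecIso S (GLCoord r S) (GLCoord r S)).inv ≫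
        (GLToBaseChange r R S ⊗ₘ GLToBaseChange r R S).left ≫
        (Functor.LaxMonoidal.μ (baseChange R S) (GLScheme r R) (GLScheme r R)).left ≫ pullback.fst _ _ ≫ (pullbackSpecIso R (GLCoord r R) (GLCoord r R)).hom = Spec.map (CommRingCat.ofHom i.toRingHom) := by
        simp only [← Category.assoc]
        rw [← Iso.eq_comp_inv]
        apply pullback.hom_ext
        · simp only [Category.assoc]
          have := Over.μ_pullback_left_fst_fst (f := Spec.map (CommRingCat.ofHom (algebraMap R S))) (GLScheme r R) (GLScheme r R)
          rw [this]
          have h2 : (GLToBaseChange r R S ⊗ₘ GLToBaseChange r R S).left ≫ pullback.fst _ _ =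
            pullback.fst _ _ ≫ (GLToBaseChange r R S).left :=
            congrArg Over.Hom.left (tensorHom_fst (GLToBaseChange r R S) (GLToBaseChange r R S))
          have h3 := pullbackSpecIso_inv_fst S (GLCoord r S) (GLCoord r S)
          have h4 := pullbackSpecIso_inv_fst R (GLCoord r R) (GLCoord r R)
          rw [reassoc_of% h2, hc]
          refine ((Category.assoc _ _ _).symm.trans (congrArg (fun t => t ≫ Spec.map
            (CommRingCat.ofHom (evalGL R (genericMatrix r S)).toRingHom)) h3)).trans
              (Eq.trans ?_ (congrArg (fun t => Spec.map (CommRingCat.ofHom i.toRingHom) ≫ t) h4).symm)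
          refine (Spec.map_comp _ _).symm.trans (Eq.trans ?_ (Spec.map_comp _ _))
          congr 1
          ext x
          simp [i]
        · simp only [Category.assoc]
          have := Over.μ_pullback_left_fst_snd (f := Spec.map (CommRingCat.ofHom (algebraMap R S))) (GLScheme r R) (GLScheme r R)
          rw [this]
          have h2 : (GLToBaseChange r R S ⊗ₘ GLToBaseChange r R S).left ≫ pullback.snd _ _ =
            pullback.snd _ _ ≫ (GLToBaseChange r R S).left :=
            congrArg Over.Hom.left (tensorHom_snd (GLToBaseChange r R S) (GLToBaseChange r R S))
          have h3 := pullbackSpecIso_inv_snd S (GLCoord r S) (GLCoord r S)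
          have h4 := pullbackSpecIso_inv_snd R (GLCoord r R) (GLCoord r R)
          rw [reassoc_of% h2, hc]
          refine ((Category.assoc _ _ _).symm.trans (congrArg (fun t => t ≫ Spec.map
            (CommRingCat.ofHom (evalGL R (genericMatrix r S)).toRingHom)) h3)).trans
              (Eq.trans ?_ (congrArg (fun t => Spec.map (CommRingCat.ofHom i.toRingHom) ≫ t) h4).symm)
          refine (Spec.map_comp _ _).symm.trans (Eq.trans ?_ (Spec.map_comp _ _))
          congr 1
          ext x
          simp [i]
      have e1 : (MonObj.mul (X := GLScheme r S)).left = (pullbackSpecIso S (GLCoord r S) (GLCoord r S)).hom ≫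
        Spec.map (CommRingCat.ofHom (comulGL r S).toRingHom) := rfl
      have e2 : (MonObj.mul (X := GLScheme r R)).left = (pullbackSpecIso R (GLCoord r R) (GLCoord r R)).hom ≫
        Spec.map (CommRingCat.ofHom (comulGL r R).toRingHom) := rfl
      have key2 := congrArg (fun t => t ≫ Spec.map (CommRingCat.ofHom (comulGL r R).toRingHom)) key
      simp only [Category.assoc] at key2
      rw [e1, e2]
      refine Eq.trans ?_ key2.symm
      rw [Category.assoc, Iso.inv_hom_id_assoc, ← Spec.map_comp, ← Spec.map_comp]
      congr 1
      have := evalGL_comp_restrict r R S (mapGL S Algebra.TensorProduct.includeLeft (genericMatrix r S) *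
    mapGL S (Algebra.TensorProduct.includeRight : _ →ₐ[S] GLCoord r S ⊗[S] GLCoord r S) (genericMatrix r S))
      have h3 := mapGL_comulGL r R i
      have h4 : mapGL R (i.comp Algebra.TensorProduct.includeLeft) (genericMatrix r R) =
         mapGL S (Algebra.TensorProduct.includeLeft : _ →ₐ[S] GLCoord r S ⊗[S] GLCoord r S) (genericMatrix r S) := by
        have : i.comp Algebra.TensorProduct.includeLeft =
            ((Algebra.TensorProduct.includeLeft : GLCoord r S →ₐ[S] GLCoord r S ⊗[S] GLCoord r S
              ).restrictScalars R).comp (evalGL R (genericMatrix r S)) := by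
          apply AlgHom.ext; intro x; simp [i]
        rw [this, comp_evalGL, evalGL_genericMatrix]
        rfl
      have h5 : mapGL R (i.comp Algebra.TensorProduct.includeRight) (genericMatrix r R) =
         mapGL S (Algebra.TensorProduct.includeRight : _ →ₐ[S] GLCoord r S ⊗[S] GLCoord r S) (genericMatrix r S) := by
        have : i.comp Algebra.TensorProduct.includeRight =
            ((Algebra.TensorProduct.includeRight : GLCoord r S →ₐ[S] GLCoord r S ⊗[S] GLCoord r S
              ).restrictScalars R).comp (evalGL R (genericMatrix r S)) := by
          apply AlgHom.ext; intro x; simp [i]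
        rw [this, comp_evalGL, evalGL_genericMatrix]
        rfl
      rw [h4, h5] at h3
      ext x
      exact DFunLike.congr_fun (this.trans h3.symm) x
    · exact (Over.w _).trans (Over.w _).symm

end Schemes

section Torsors

variable {S : Scheme.{u}}

/-- The morphism `j : H ⟶ G` makes the group scheme `H` a closed subgroup scheme of `G`. -/
structure IsClosedSubgroupScheme {G H : Over S} [GrpObj G] [GrpObj H] (j : H ⟶ G) : Prop where
  isClosedImmersion : IsClosedImmersion j.left
  isMonHom : IsMonHom j

/-- The morphism `a : X × H ⟶ X` makes `X` a right `H`-torsor: `a` is a right action, `X ⟶ S` is an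
fppf cover, and `(x, h) ↦ (x, x h)` is an isomorphism from `X × H` to `X × X`. -/
structure IsRightTorsor {X H : Over S} [GrpObj H] (a : X ⊗ H ⟶ X) : Prop where
  act_one : X ◁ MonObj.one (X := H) ≫ a = (ρ_ X).hom
  act_mul : a ▷ H ≫ a = (α_ X H H).hom ≫ X ◁ MonObj.mul (X := H) ≫ a
  flat : Flat X.hom
  surjective : Surjective X.hom
  locallyOfFinitePresentation : LocallyOfFinitePresentation X.hom
  isIso : IsIso (lift (fst X H) a)

/-- The morphism `a : H × X ⟶ X` makes `X` a left `H`-torsor: `a` is a left action, `X ⟶ S` is an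
fppf cover, and `(h, x) ↦ (h x, x)` is an isomorphism from `H × X` to `X × X`. -/
structure IsLeftTorsor {X H : Over S} [GrpObj H] (a : H ⊗ X ⟶ X) : Prop where
  one_act : MonObj.one (X := H) ▷ X ≫ a = (λ_ X).hom
  mul_act : H ◁ a ≫ a = (α_ H H X).inv ≫ MonObj.mul (X := H) ▷ X ≫ a
  flat : Flat X.hom
  surjective : Surjective X.hom
  locallyOfFinitePresentation : LocallyOfFinitePresentation X.hom
  isIso : IsIso (lift a (snd H X))

/-- The subscheme `i : X ⟶ G` of the group scheme `G` is stable under right multiplication by the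
subgroup scheme `j : H ⟶ G`, and right multiplication makes it an `H`-torsor. -/
def IsRightTorsorIn {G X H : Over S} [GrpObj G] [GrpObj H] (i : X ⟶ G) (j : H ⟶ G) : Prop :=
  ∃ a : X ⊗ H ⟶ X, a ≫ i = (i ⊗ₘ j) ≫ MonObj.mul (X := G) ∧ IsRightTorsor a

/-- The subscheme `i : X ⟶ G` of the group scheme `G` is stable under left multiplication by the
subgroup scheme `j : H ⟶ G`, and left multiplication makes it an `H`-torsor. -/
def IsLeftTorsorIn {G X H : Over S} [GrpObj G] [GrpObj H] (i : X ⟶ G) (j : H ⟶ G) : Prop :=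
  ∃ a : H ⊗ X ⟶ X, a ≫ i = (j ⊗ₘ i) ≫ MonObj.mul (X := G) ∧ IsLeftTorsor a

end Torsors

section Frobenius

variable {d : ℕ} {F E : Type u} {L : ZMod d → Type v} [Field F] [Field E] [∀ l, Field (L l)]
  [Algebra F E] [∀ l, Algebra E (L l)] [∀ l, Algebra F (L l)] [∀ l, IsScalarTower F E (L l)]

variable (F E) in
/-- `(F, E, ∏ l, L l)` is a `σ`-admissible triple: `σ` maps `E` into `E` and the factor `L l` into
the factor `L (l + 1)`, the field `F` is the ring of `σ`-invariants of `E` and of `∏ l, L l`, and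
`∏ l, L l` is separable over the field `E`, which means that it stays reduced after tensoring with
an algebraic closure of `E`. -/
structure IsSigmaAdmissible (σ : (∀ l, L l) →+* (∀ l, L l)) : Prop where
  map_base : ∀ x : E, ∃ y : E, σ (algebraMap E (∀ l, L l) x) = algebraMap E (∀ l, L l) y
  map_component : ∀ (l : ZMod d) (x : L l), ∃ y : L (l + 1),
    σ (Pi.single l x) = Pi.single (l + 1) y
  fixed_base : ∀ x : E, σ (algebraMap E (∀ l, L l) x) = algebraMap E (∀ l, L l) x ↔
    x ∈ Set.range (algebraMap F E)
  fixed : ∀ x : (∀ l, L l), σ x = x ↔ x ∈ Set.range (algebraMap F (∀ l, L l))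
  separable : Algebra.IsGeometricallyReduced E (∀ l, L l)

variable {r : ℕ}

/-- `Ψ` is a fundamental matrix for `Φ`, that is, `σ(Ψ) = Φ Ψ`. -/
def IsFundamentalMatrix (σ : (∀ l, L l) →+* (∀ l, L l)) (Φ : GL (Fin r) E)
    (Ψ : GL (Fin r) (∀ l, L l)) : Prop :=
  Matrix.GeneralLinearGroup.map σ Ψ =
    Matrix.GeneralLinearGroup.map (algebraMap E (∀ l, L l)) Φ * Ψ

/-- The component `Ψ_l ∈ GL_r(L_l)` of `Ψ` at `l`. -/
def component (Ψ : GL (Fin r) (∀ l, L l)) (l : ZMod d) : GL (Fin r) (L l) :=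
  Matrix.GeneralLinearGroup.map (Pi.evalRingHom L l) Ψ

variable (E) in
/-- For invertible matrices `M` over `A` and `N` over `B`, the matrix `(M ⊗ 1)⁻¹ (1 ⊗ N)`. -/
def tensorQuotient {A B : Type v} [CommRing A] [CommRing B] [Algebra E A] [Algebra E B]
    (M : GL (Fin r) A) (N : GL (Fin r) B) : GL (Fin r) (A ⊗[E] B) :=
  (mapGL E (Algebra.TensorProduct.includeLeft : A →ₐ[E] A ⊗[E] B) M)⁻¹ *
    mapGL E (Algebra.TensorProduct.includeRight : B →ₐ[E] A ⊗[E] B) N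

variable (E) in
/-- `𝔭`, the kernel of `E[X, Δ⁻¹] → L`, `X ↦ Ψ`. -/
def idealZ (Ψ : GL (Fin r) (∀ l, L l)) : Ideal (GLCoord r E) :=
  RingHom.ker (evalGL E Ψ)

variable (E) in
/-- `𝔭_l`, the kernel of `E[X, Δ⁻¹] → L_l`, `X ↦ Ψ_l`. -/
def idealZComp (Ψ : GL (Fin r) (∀ l, L l)) (l : ZMod d) : Ideal (GLCoord r E) :=
  RingHom.ker (evalGL E (component Ψ l))

variable (F E) in
/-- `𝔮`, the kernel of `F[X, Δ⁻¹] → L ⊗_E L`, `X ↦ (Ψ ⊗ 1)⁻¹ (1 ⊗ Ψ)`. -/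
def idealΓ (Ψ : GL (Fin r) (∀ l, L l)) : Ideal (GLCoord r F) :=
  RingHom.ker (evalGL F (tensorQuotient E Ψ Ψ))

variable (F E) in
/-- `𝔮_m`, the kernel of `F[X, Δ⁻¹] → L_0 ⊗_E L_m`, `X ↦ (Ψ_0 ⊗ 1)⁻¹ (1 ⊗ Ψ_m)`. -/
def idealΓComp (Ψ : GL (Fin r) (∀ l, L l)) (m : ZMod d) : Ideal (GLCoord r F) :=
  RingHom.ker (evalGL F (tensorQuotient E (component Ψ 0) (component Ψ m)))

end Frobenius

end FrobeniusTorsor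

end

open FrobeniusTorsor

/-!
The group `Γ` and the torsors under it are closed subschemes of `GL_r`, and their universal points
are invertible matrices over the coordinate rings. All assertions are first reduced to assertions
about these matrices. Inside the group `GL_r` a right action of a subgroup `H` on a subscheme `X`
exists as soon as products `x h` lie in `X`, it satisfies the axioms because the inclusions are
monomorphisms, and it is a torsor as soon as the quotients `x⁻¹ y` lie in `H`: the latter give the
inverse of `(x, h) ↦ (x, x h)` (`isRightTorsorIn_of_mono`, `isLeftTorsorIn_of_mono`). Flatness and
finite presentation are automatic over a field, and surjectivity means that the coordinate ring is
not zero.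

So one has to show that certain equations, which hold for products such as
`(M⁻¹ ⊗ N) (N⁻¹ ⊗ O) = M⁻¹ ⊗ O` in `A ⊗_E B ⊗_E C`, still hold when the two factors vary
independently over `F`. The point is that `F[M⁻¹ ⊗ N] ⊗_F F[N⁻¹ ⊗ O]` embeds into
`A ⊗_E B ⊗_E C` (`evalGL_leftGL_mul_rightGL`). By flatness this follows from the injectivity of
`B ⊗_F F[N⁻¹ ⊗ O] → B ⊗_E C`. Since `σ(N) = Φ N` and `σ(O) = Φ O`, the matrix `N⁻¹ ⊗ O` is
invariant under `σ ⊗ σ`; and invariants that are linearly independent over `F` are linearly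
independent over `B` when `B` has no proper nonzero `σ`-stable ideal and `B^σ = F`
(`IsSimpleDifferenceRing.injective_liftBaseChange`).

This applies to `L = ∏ L_l` with `σ`, where `σ` permutes the factors cyclically, and to each field
`L_l` with the endomorphism induced by `σ ^ d`, whose invariants are again `F`: if `x ∈ L_l` is
invariant, then the sum of its images under `1, σ, …, σ ^ (d - 1)` is an element of `L^σ = F`.
Finally, powers of `σ` map `Ψ_l⁻¹ ⊗ Ψ_l` to `Ψ_m⁻¹ ⊗ Ψ_m` for all `l` and `m`, so that all
components define the same group (`IsSigmaAdmissible.quotientIdeal_component_eq`), which acts on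
every `Z_l` and every `Γ_m`.
-/

noncomputable section

namespace FrobeniusTorsor

/-! ### Subgroups and torsors cut out by monomorphisms -/

section Mono

open scoped MonObj

variable {C : Type*} [Category* C] [CartesianMonoidalCategory C]

theorem tensorHom_comp_mul {G X Y : C} [MonObj G] (f : X ⟶ G) (g : Y ⟶ G) :
    (f ⊗ₘ g) ≫ μ[G] = (fst X Y ≫ f) * (snd X Y ≫ g) := by
  rw [Hom.mul_def]
  congr 1
  ext <;> simp

/-- A subobject of a group object that is closed under unit, multiplication and inversion is a
group object. -/
abbrev grpObjOfMono {G H : C} [GrpObj G] (j : H ⟶ G) [Mono j] (e : 𝟙_ C ⟶ H) (he : e ≫ j = 1)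
    (m : H ⊗ H ⟶ H) (hm : m ≫ j = (fst H H ≫ j) * (snd H H ≫ j))
    (n : H ⟶ H) (hn : n ≫ j = j⁻¹) : GrpObj H where
  one := e
  mul := m
  inv := n
  one_mul := by
    simp [leftUnitor_hom, ← cancel_mono j, hm, MonObj.comp_mul, he, MonObj.comp_one]
  mul_one := by
    simp [rightUnitor_hom, ← cancel_mono j, hm, MonObj.comp_mul, he, MonObj.comp_one]
  mul_assoc := by
    simp [← cancel_mono j, hm, MonObj.comp_mul, mul_assoc]
  left_inv := by
    simp [← cancel_mono j, hm, hn, MonObj.comp_mul, he, MonObj.comp_one]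
  right_inv := by
    simp [← cancel_mono j, hm, hn, MonObj.comp_mul, he, MonObj.comp_one]

theorem isMonHom_grpObjOfMono {G H : C} [GrpObj G] (j : H ⟶ G) [Mono j] (e : 𝟙_ C ⟶ H)
    (he : e ≫ j = 1) (m : H ⊗ H ⟶ H) (hm : m ≫ j = (fst H H ≫ j) * (snd H H ≫ j))
    (n : H ⟶ H) (hn : n ≫ j = j⁻¹) :
    letI := grpObjOfMono j e he m hm n hn
    IsMonHom j :=
  letI := grpObjOfMono j e he m hm n hn
  { one_hom := he.trans (MonObj.one_eq_one _).symm
    mul_hom := hm.trans (tensorHom_comp_mul j j).symm }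

end Mono

section TorsorCriterion

open scoped MonObj

variable {S : Scheme.{u}} {G X H : Over S} [GrpObj G] [GrpObj H]

/-- A right action inside a group scheme is a torsor as soon as the quotients `x⁻¹ y` of its points
lie in the acting subgroup: these quotients provide the inverse of `(x, h) ↦ (x, x h)`, and all
other identities can be tested in the ambient group. -/
theorem isRightTorsorIn_of_mono (i : X ⟶ G) (j : H ⟶ G) [Mono i] [Mono j] [IsMonHom j]
    (flat : Flat X.hom) (surjective : Surjective X.hom)
    (lofp : LocallyOfFinitePresentation X.hom)
    (a : X ⊗ H ⟶ X) (ha : a ≫ i = (fst X H ≫ i) * (snd X H ≫ j))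
    (b : X ⊗ X ⟶ H) (hb : b ≫ j = (fst X X ≫ i)⁻¹ * (snd X X ≫ i)) :
    IsRightTorsorIn i j := by
  refine ⟨a, ha.trans (tensorHom_comp_mul i j).symm,
    ⟨?_, ?_, flat, surjective, lofp, ⟨lift (fst X X) b, ?_, ?_⟩⟩⟩
  · simp [← cancel_mono i, ha, MonObj.comp_mul, MonObj.one_eq_one, MonObj.comp_one, rightUnitor_hom]
  · simp [← cancel_mono i, ha, MonObj.comp_mul, IsMonHom.mul_hom, tensorHom_comp_mul,
      mul_assoc]
  · ext1
    · simp
    · simp [← cancel_mono j, ha, hb, MonObj.comp_mul, GrpObj.comp_inv]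
  · ext1
    · simp
    · simp [← cancel_mono i, ha, hb, MonObj.comp_mul]

/-- The analogue of `isRightTorsorIn_of_mono` for left actions, with the quotients `x y⁻¹`. -/
theorem isLeftTorsorIn_of_mono (i : X ⟶ G) (j : H ⟶ G) [Mono i] [Mono j] [IsMonHom j]
    (flat : Flat X.hom) (surjective : Surjective X.hom)
    (lofp : LocallyOfFinitePresentation X.hom)
    (a : H ⊗ X ⟶ X) (ha : a ≫ i = (fst H X ≫ j) * (snd H X ≫ i))
    (b : X ⊗ X ⟶ H) (hb : b ≫ j = (fst X X ≫ i) * (snd X X ≫ i)⁻¹) :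
    IsLeftTorsorIn i j := by
  refine ⟨a, ha.trans (tensorHom_comp_mul j i).symm,
    ⟨?_, ?_, flat, surjective, lofp, ⟨lift b (snd X X), ?_, ?_⟩⟩⟩
  · simp [← cancel_mono i, ha, MonObj.comp_mul, MonObj.one_eq_one, MonObj.comp_one, leftUnitor_hom]
  · simp [← cancel_mono i, ha, MonObj.comp_mul, IsMonHom.mul_hom, tensorHom_comp_mul,
      mul_assoc]
  · ext1
    · simp [← cancel_mono j, ha, hb, MonObj.comp_mul, GrpObj.comp_inv]
    · simp
  · ext1
    · simp [← cancel_mono i, ha, hb, MonObj.comp_mul]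
    · simp

end TorsorCriterion

/-! ### Points of `GL_r` with values in algebras -/

section Points

open scoped MonObj
open Limits

variable {r : ℕ} {R : Type u} [CommRing R]
variable {A B C : Type u} [CommRing A] [Algebra R A] [CommRing B] [Algebra R B] [CommRing C]
  [Algebra R C]

/-- The morphism `Spec B ⟶ Spec A` over `Spec R` given by a homomorphism of `R`-algebras. -/
def specOverMap (f : A →ₐ[R] B) : specOver R B ⟶ specOver R A :=
  Over.homMk (Spec.map (CommRingCat.ofHom f.toRingHom)) (by
    simp only [Over.mk_hom, ← Spec.map_comp, ← CommRingCat.ofHom_comp]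
    congr 2
    ext x
    exact f.commutes x)

theorem specOverMap_comp (g : B →ₐ[R] C) (f : A →ₐ[R] B) :
    specOverMap (g.comp f) = specOverMap g ≫ specOverMap f := by
  ext1
  exact Spec.map_comp (CommRingCat.ofHom f.toRingHom) (CommRingCat.ofHom g.toRingHom)

/-- The point of `GL_r` over `Spec A` given by an invertible matrix over `A`. -/
def pointGL (M : GL (Fin r) A) : specOver R A ⟶ GLScheme r R :=
  specOverMap (evalGL R M)

theorem specOverMap_comp_pointGL (f : A →ₐ[R] B) (M : GL (Fin r) A) :
    specOverMap f ≫ pointGL M = pointGL (R := R) (mapGL R f M) := by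
  rw [pointGL, ← specOverMap_comp, comp_evalGL, pointGL]

theorem mono_specOverMap (f : A →ₐ[R] B) (hf : Function.Surjective f) :
    Mono (specOverMap f) := by
  have : IsClosedImmersion (specOverMap f).left := IsClosedImmersion.spec_of_surjective _ hf
  exact Over.mono_of_mono_left _

/-- The comparison `Spec (A ⊗ B) ⟶ Spec A × Spec B`. -/
def specTensor (A B : Type u) [CommRing A] [Algebra R A] [CommRing B] [Algebra R B] :
    specOver R (A ⊗[R] B) ⟶ specOver R A ⊗ specOver R B :=
  lift (specOverMap Algebra.TensorProduct.includeLeft)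
    (specOverMap Algebra.TensorProduct.includeRight)

theorem specTensor_left :
    (specTensor (R := R) A B).left = (pullbackSpecIso R A B).inv := by
  apply pullback.hom_ext
  · refine Eq.trans ?_ (pullbackSpecIso_inv_fst R A B).symm
    exact congrArg (fun f => f.left) (lift_fst
      (specOverMap (Algebra.TensorProduct.includeLeft : A →ₐ[R] A ⊗[R] B))
      (specOverMap (Algebra.TensorProduct.includeRight : B →ₐ[R] A ⊗[R] B)))
  · refine Eq.trans ?_ (pullbackSpecIso_inv_snd R A B).symm
    exact congrArg (fun f => f.left) (lift_snd
      (specOverMap (Algebra.TensorProduct.includeLeft : A →ₐ[R] A ⊗[R] B))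
      (specOverMap (Algebra.TensorProduct.includeRight : B →ₐ[R] A ⊗[R] B)))

instance isIso_specTensor : IsIso (specTensor (R := R) A B) := by
  have : IsIso ((Over.forget _).map (specTensor (R := R) A B)) := by
    rw [Over.forget_map, specTensor_left]
    exact Iso.isIso_inv (pullbackSpecIso R A B)
  exact isIso_of_reflects_iso _ (Over.forget _)

theorem specTensor_fst :
    specTensor A B ≫ fst (specOver R A) (specOver R B) =
      specOverMap Algebra.TensorProduct.includeLeft := lift_fst _ _

theorem specTensor_snd :
    specTensor A B ≫ snd (specOver R A) (specOver R B) =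
      specOverMap Algebra.TensorProduct.includeRight := lift_snd _ _

/-- The first of the two copies of a matrix in a tensor product. -/
abbrev leftGL (B : Type w) [CommRing B] [Algebra R B] {A : Type v} [CommRing A] [Algebra R A]
    (M : GL (Fin r) A) : GL (Fin r) (A ⊗[R] B) :=
  mapGL R (Algebra.TensorProduct.includeLeft : A →ₐ[R] A ⊗[R] B) M

/-- The second of the two copies of a matrix in a tensor product. -/
abbrev rightGL (A : Type v) [CommRing A] [Algebra R A] {B : Type w} [CommRing B] [Algebra R B]
    (N : GL (Fin r) B) : GL (Fin r) (A ⊗[R] B) :=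
  mapGL R (Algebra.TensorProduct.includeRight : B →ₐ[R] A ⊗[R] B) N

theorem mul_GLScheme_left :
    specTensor (GLCoord r R) (GLCoord r R) ≫ μ[GLScheme r R] = specOverMap (comulGL r R) := by
  ext1
  rw [Over.comp_left, specTensor_left]
  exact (Iso.inv_comp_eq _).2 rfl

theorem pointGL_mul (M N : GL (Fin r) A) :
    pointGL (R := R) (M * N) = pointGL M * pointGL N := by
  let g : GLCoord r R ⊗[R] GLCoord r R →ₐ[R] A :=
    Algebra.TensorProduct.lift (evalGL R M) (evalGL R N) fun _ _ => Commute.all _ _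
  have hM : g.comp Algebra.TensorProduct.includeLeft = evalGL R M :=
    Algebra.TensorProduct.lift_comp_includeLeft _ _ fun _ _ => Commute.all _ _
  have hN : g.comp Algebra.TensorProduct.includeRight = evalGL R N :=
    Algebra.TensorProduct.lift_comp_includeRight _ _ fun _ _ => Commute.all _ _
  have h : evalGL R (M * N) = g.comp (comulGL r R) := by
    rw [mapGL_comulGL, hM, hN, evalGL_genericMatrix, evalGL_genericMatrix]
  have hl : specOverMap g ≫ specTensor _ _ = lift (pointGL M) (pointGL N) := by
    ext1
    · rw [Category.assoc, specTensor_fst, ← specOverMap_comp, hM, lift_fst, pointGL]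
    · rw [Category.assoc, specTensor_snd, ← specOverMap_comp, hN, lift_snd, pointGL]
  rw [Hom.mul_def, ← hl, Category.assoc, mul_GLScheme_left, ← specOverMap_comp, ← h, pointGL]

theorem pointGL_one : pointGL (R := R) (1 : GL (Fin r) A) = 1 := by
  have h := pointGL_mul (R := R) (1 : GL (Fin r) A) 1
  rw [mul_one] at h
  exact left_eq_mul.1 h

theorem pointGL_inv (M : GL (Fin r) A) : pointGL (R := R) M⁻¹ = (pointGL M)⁻¹ := by
  rw [eq_inv_iff_mul_eq_one, ← pointGL_mul, inv_mul_cancel, pointGL_one]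

theorem specTensor_fst_pointGL (M : GL (Fin r) A) :
    specTensor A B ≫ fst (specOver R A) (specOver R B) ≫ pointGL M = pointGL (leftGL B M) := by
  rw [← Category.assoc, specTensor_fst, specOverMap_comp_pointGL]

theorem specTensor_snd_pointGL (N : GL (Fin r) B) :
    specTensor A B ≫ snd (specOver R A) (specOver R B) ≫ pointGL N = pointGL (rightGL A N) := by
  rw [← Category.assoc, specTensor_snd, specOverMap_comp_pointGL]

/-- The image of the generic matrix in `R[X, Δ⁻¹] / I`. -/
def quotientMatrix (I : Ideal (GLCoord r R)) : GL (Fin r) (GLCoord r R ⧸ I) :=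
  mapGL R (Ideal.Quotient.mkₐ R I) (genericMatrix r R)

theorem evalGL_quotientMatrix (I : Ideal (GLCoord r R)) :
    evalGL R (quotientMatrix I) = Ideal.Quotient.mkₐ R I :=
  evalGL_eq_of rfl

theorem closedSubι_eq_pointGL (I : Ideal (GLCoord r R)) :
    closedSubι I = pointGL (quotientMatrix I) := by
  rw [pointGL, evalGL_quotientMatrix]
  rfl

instance mono_closedSubι (I : Ideal (GLCoord r R)) : Mono (closedSubι I) :=
  mono_specOverMap (Ideal.Quotient.mkₐ R I) Ideal.Quotient.mk_surjective

theorem isClosedImmersion_closedSubι (I : Ideal (GLCoord r R)) :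
    IsClosedImmersion (closedSubι I).left :=
  IsClosedImmersion.spec_of_surjective _ Ideal.Quotient.mk_surjective

/-- A matrix that satisfies the equations in `I` is the image of the generic one modulo `I`. -/
theorem exists_mapGL_quotientMatrix {A : Type v} [CommRing A] [Algebra R A]
    {I : Ideal (GLCoord r R)} {M : GL (Fin r) A} (h : ∀ f ∈ I, evalGL R M f = 0) :
    ∃ g : (GLCoord r R ⧸ I) →ₐ[R] A, mapGL R g (quotientMatrix I) = M := by
  refine ⟨Ideal.Quotient.liftₐ I (evalGL R M) h, ?_⟩
  rw [quotientMatrix, mapGL_mapGL, Ideal.Quotient.liftₐ_comp, evalGL_genericMatrix]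

theorem evalGL_mapGL_eq_zero {A : Type v} {B : Type w} [CommRing A] [Algebra R A] [CommRing B]
    [Algebra R B] (g : A →ₐ[R] B) {M : GL (Fin r) A} {f : GLCoord r R} (h : evalGL R M f = 0) :
    evalGL R (mapGL R g M) f = 0 := by
  rw [← comp_evalGL, AlgHom.comp_apply, h, map_zero]

theorem evalGL_eq_zero_of_injective {A : Type v} {B : Type w} [CommRing A] [Algebra R A]
    [CommRing B] [Algebra R B] (g : A →ₐ[R] B) (hg : Function.Injective g) {M : GL (Fin r) A}
    {f : GLCoord r R} (h : evalGL R (mapGL R g M) f = 0) : evalGL R M f = 0 := by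
  rw [← comp_evalGL, AlgHom.comp_apply] at h
  exact hg (h.trans (map_zero g).symm)

end Points

/-! ### Subgroups and torsors in terms of equations -/

section Affine

open scoped MonObj
open Limits

variable {r : ℕ}

/-- The closed subscheme of `GL_r` cut out by `I` is a closed subgroup scheme if the unit matrix,
products and inverses satisfy the equations in `I`. -/
theorem exists_isClosedSubgroupScheme {R : Type u} [CommRing R] (I : Ideal (GLCoord r R))
    (hone : ∀ f ∈ I, evalGL R (1 : GL (Fin r) R) f = 0)
    (hmul : ∀ f ∈ I, evalGL R (leftGL (R := R) _ (quotientMatrix I) * rightGL (R := R) _ (quotientMatrix I)) f = 0)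
    (hinv : ∀ f ∈ I, evalGL R (quotientMatrix I)⁻¹ f = 0) :
    ∃ _ : GrpObj (closedSub I), IsClosedSubgroupScheme (closedSubι I) := by
  obtain ⟨e, he⟩ := exists_mapGL_quotientMatrix hone
  obtain ⟨m, hm⟩ := exists_mapGL_quotientMatrix hmul
  obtain ⟨n, hn⟩ := exists_mapGL_quotientMatrix hinv
  let u : 𝟙_ (Over (Spec (CommRingCat.of R))) ⟶ specOver R R :=
    Over.homMk (𝟙 _) (by
      refine (Category.id_comp _).trans ?_
      exact Spec.map_id (CommRingCat.of R))
  have hι := closedSubι_eq_pointGL I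
  have he' : (u ≫ specOverMap e) ≫ closedSubι I = 1 := by
    rw [hι, Category.assoc, specOverMap_comp_pointGL, he, pointGL_one, MonObj.comp_one]
  have hm' : (inv (specTensor _ _) ≫ specOverMap m) ≫ closedSubι I =
      (fst (closedSub I) (closedSub I) ≫ closedSubι I) *
        (snd (closedSub I) (closedSub I) ≫ closedSubι I) := by
    rw [Category.assoc, IsIso.inv_comp_eq, hι, specOverMap_comp_pointGL, hm, pointGL_mul,
      MonObj.comp_mul, specTensor_fst_pointGL, specTensor_snd_pointGL]
  have hn' : specOverMap n ≫ closedSubι I = (closedSubι I)⁻¹ := by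
    rw [hι, specOverMap_comp_pointGL, hn, pointGL_inv]
  let := grpObjOfMono (closedSubι I) _ he' _ hm' _ hn'
  exact ⟨this, isClosedImmersion_closedSubι I,
    isMonHom_grpObjOfMono (closedSubι I) _ he' _ hm' _ hn'⟩

section Field

variable {k : Type u} [Field k]

instance finiteType_GLCoord : Algebra.FiniteType k (GLCoord r k) :=
  Algebra.FiniteType.trans (S := MvPolynomial (Fin r × Fin r) k) inferInstance
    (IsLocalization.finiteType_of_monoid_fg
      (Submonoid.powers (Matrix.mvPolynomialX (Fin r) (Fin r) k).det) _)

theorem flat_specOver (A : Type u) [CommRing A] [Algebra k A] : Flat (specOver k A).hom := by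
  change Flat (Spec.map _)
  rw [HasRingHomProperty.Spec_iff (P := @Flat)]
  exact (RingHom.flat_algebraMap_iff).2 inferInstance

theorem surjective_specOver (A : Type u) [CommRing A] [Algebra k A] [Nontrivial A] :
    Surjective (specOver k A).hom :=
  ⟨fun _ => ⟨Classical.arbitrary (PrimeSpectrum A), Subsingleton.elim (α := PrimeSpectrum k) _ _⟩⟩

theorem locallyOfFinitePresentation_specOver (A : Type u) [CommRing A] [Algebra k A]
    [Algebra.FiniteType k A] : LocallyOfFinitePresentation (specOver k A).hom := by
  change LocallyOfFinitePresentation (Spec.map _)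
  rw [HasRingHomProperty.Spec_iff (P := @LocallyOfFinitePresentation)]
  exact (RingHom.finitePresentation_algebraMap).2
    ((Algebra.FinitePresentation.of_finiteType).1 inferInstance)

/-- A right torsor in equations: here the group `G` may be any group scheme that contains `GL_r`,
and the acting subgroup may be given up to isomorphism, so that the criterion applies to base
changes. -/
theorem isRightTorsorIn_pointGL {A B : Type u} [CommRing A] [CommRing B] [Algebra k A] [Algebra k B]
    [Nontrivial A] [Algebra.FiniteType k A] {U : GL (Fin r) A} {V : GL (Fin r) B}
    {G H : Over (Spec (CommRingCat.of k))} [GrpObj G] [GrpObj H]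
    (φ : GLScheme r k ⟶ G) [IsMonHom φ] [Mono φ] [Mono (pointGL (R := k) U)]
    (j : H ⟶ G) [Mono j] [IsMonHom j] (ψ : specOver k B ≅ H) (hψ : ψ.hom ≫ j = pointGL V ≫ φ)
    (a : A →ₐ[k] A ⊗[k] B) (ha : mapGL k a U = leftGL B U * rightGL A V)
    (b : B →ₐ[k] A ⊗[k] A) (hb : mapGL k b V = (leftGL A U)⁻¹ * rightGL A U) :
    IsRightTorsorIn (pointGL U ≫ φ) j := by
  have := mono_comp (pointGL (R := k) U) φ
  have hj : j = ψ.inv ≫ pointGL V ≫ φ := (Iso.eq_inv_comp ψ).2 hψ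
  refine isRightTorsorIn_of_mono _ j (flat_specOver A) (surjective_specOver A)
    (locallyOfFinitePresentation_specOver A)
    ((specOver k A ◁ ψ.inv) ≫ inv (specTensor _ _) ≫ specOverMap a) ?_
    (inv (specTensor _ _) ≫ specOverMap b ≫ ψ.hom) ?_
  · have h : (fst (specOver k A) H ≫ pointGL U ≫ φ) * (snd (specOver k A) H ≫ j) =
        (specOver k A ◁ ψ.inv) ≫ ((fst _ _ ≫ pointGL U) * (snd _ _ ≫ pointGL V)) ≫ φ := by
      rw [hj, MonObj.mul_comp, MonObj.comp_mul]
      simp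
    rw [h, Category.assoc]
    congr 1
    rw [Category.assoc, IsIso.inv_comp_eq, ← Category.assoc, specOverMap_comp_pointGL, ha,
      pointGL_mul, ← Category.assoc, MonObj.comp_mul, specTensor_fst_pointGL,
      specTensor_snd_pointGL]
  · rw [Category.assoc, IsIso.inv_comp_eq, Category.assoc, hψ, ← Category.assoc,
      specOverMap_comp_pointGL, hb, pointGL_mul, pointGL_inv, MonObj.comp_mul, GrpObj.comp_inv,
      MonObj.mul_comp, GrpObj.inv_comp, ← specTensor_fst_pointGL, ← specTensor_snd_pointGL]
    simp only [Category.assoc]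

theorem isRightTorsorIn_closedSub {I J : Ideal (GLCoord r k)} (hI : I ≠ ⊤)
    [GrpObj (closedSub J)] [IsMonHom (closedSubι J)]
    (hmul : ∀ f ∈ I, evalGL k (leftGL (R := k) _ (quotientMatrix I) * rightGL (R := k) _ (quotientMatrix J)) f = 0)
    (hdiv : ∀ f ∈ J,
      evalGL k ((leftGL (R := k) _ (quotientMatrix I))⁻¹ * rightGL (R := k) _ (quotientMatrix I)) f = 0) :
    IsRightTorsorIn (closedSubι I) (closedSubι J) := by
  obtain ⟨a, ha⟩ := exists_mapGL_quotientMatrix hmul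
  obtain ⟨b, hb⟩ := exists_mapGL_quotientMatrix hdiv
  have : Nontrivial (GLCoord r k ⧸ I) := Ideal.Quotient.nontrivial_iff.2 hI
  have : Mono (pointGL (R := k) (quotientMatrix I)) :=
    closedSubι_eq_pointGL I ▸ mono_closedSubι I
  have h := isRightTorsorIn_pointGL (𝟙 (GLScheme r k)) (closedSubι J) (Iso.refl (closedSub J))
    (by rw [Iso.refl_hom, Category.id_comp, Category.comp_id, closedSubι_eq_pointGL]) a ha b hb
  rwa [Category.comp_id, ← closedSubι_eq_pointGL] at h

theorem isLeftTorsorIn_closedSub {I J : Ideal (GLCoord r k)} (hI : I ≠ ⊤)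
    [GrpObj (closedSub J)] [IsMonHom (closedSubι J)]
    (hmul : ∀ f ∈ I, evalGL k (leftGL (R := k) _ (quotientMatrix J) * rightGL (R := k) _ (quotientMatrix I)) f = 0)
    (hdiv : ∀ f ∈ J,
      evalGL k (leftGL (R := k) _ (quotientMatrix I) * (rightGL (R := k) _ (quotientMatrix I))⁻¹) f = 0) :
    IsLeftTorsorIn (closedSubι I) (closedSubι J) := by
  obtain ⟨a, ha⟩ := exists_mapGL_quotientMatrix hmul
  obtain ⟨b, hb⟩ := exists_mapGL_quotientMatrix hdiv
  have : Nontrivial (GLCoord r k ⧸ I) := Ideal.Quotient.nontrivial_iff.2 hI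
  refine isLeftTorsorIn_of_mono _ _ (flat_specOver _) (surjective_specOver _)
    (locallyOfFinitePresentation_specOver _) (inv (specTensor _ _) ≫ specOverMap a) ?_
    (inv (specTensor _ _) ≫ specOverMap b) ?_
  · rw [Category.assoc, IsIso.inv_comp_eq, closedSubι_eq_pointGL, closedSubι_eq_pointGL,
      specOverMap_comp_pointGL, ha, pointGL_mul, MonObj.comp_mul, specTensor_fst_pointGL,
      specTensor_snd_pointGL]
  · rw [Category.assoc, IsIso.inv_comp_eq, closedSubι_eq_pointGL, closedSubι_eq_pointGL,
      specOverMap_comp_pointGL, hb, pointGL_mul, pointGL_inv, MonObj.comp_mul, GrpObj.comp_inv,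
      specTensor_fst_pointGL, specTensor_snd_pointGL]

end Field

section BaseChange

variable (R S : Type u) [CommRing R] [CommRing S] [Algebra R S] (B : Type u) [CommRing B]
  [Algebra R B]

/-- The comparison `Spec (S ⊗ B) ⟶ Spec B ×_R S`. -/
def specBaseChange : specOver S (S ⊗[R] B) ⟶ (baseChange R S).obj (specOver R B) :=
  Over.homMk (pullback.lift
    (Spec.map (CommRingCat.ofHom (Algebra.TensorProduct.includeRight : B →ₐ[R] S ⊗[R] B).toRingHom))
    (Spec.map (CommRingCat.ofHom (algebraMap S (S ⊗[R] B))))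
    (isPullback_SpecMap_of_isPushout _ _ _ _ (CommRingCat.isPushout_tensorProduct R S B).flip).w)
    (pullback.lift_snd _ _ _)

instance isIso_specBaseChange : IsIso (specBaseChange R S B) := by
  let h := isPullback_SpecMap_of_isPushout _ _ _ _ (CommRingCat.isPushout_tensorProduct R S B).flip
  have h' : (specBaseChange R S B).left = h.isoPullback.hom := by
    apply pullback.hom_ext
    · exact (pullback.lift_fst _ _ _).trans (IsPullback.isoPullback_hom_fst _).symm
    · exact (pullback.lift_snd _ _ _).trans (IsPullback.isoPullback_hom_snd _).symm
  have : IsIso ((Over.forget _).map (specBaseChange R S B)) := by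
    rw [Over.forget_map, h']
    exact Iso.isIso_hom _
  exact isIso_of_reflects_iso _ (Over.forget _)

variable {B}

theorem specBaseChange_comp (V : GL (Fin r) B) :
    specBaseChange R S B ≫ (baseChange R S).map (pointGL V) =
      pointGL (R := S) (rightGL (R := R) S V) ≫ GLToBaseChange r R S := by
  ext1
  apply pullback.hom_ext
  · have h1 : ((baseChange R S).map (pointGL (R := R) V)).left ≫ pullback.fst _ _ =
        pullback.fst _ _ ≫ (pointGL (R := R) V).left := pullback.lift_fst _ _ _
    have h2 : (GLToBaseChange r R S).left ≫ pullback.fst _ _ =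
        Spec.map (CommRingCat.ofHom (evalGL R (genericMatrix r S)).toRingHom) :=
      pullback.lift_fst _ _ _
    have h3 : (specBaseChange R S B).left ≫ pullback.fst _ _ = Spec.map (CommRingCat.ofHom
        (Algebra.TensorProduct.includeRight : B →ₐ[R] S ⊗[R] B).toRingHom) :=
      pullback.lift_fst _ _ _
    rw [Over.comp_left, Over.comp_left, Category.assoc, Category.assoc]
    refine (congrArg _ h1).trans (Eq.trans ?_ (congrArg _ h2).symm)
    refine (Category.assoc _ _ _).symm.trans ((congrArg (fun t => t ≫ _) h3).trans ?_)
    refine (Spec.map_comp _ _).symm.trans (Eq.trans ?_ (Spec.map_comp _ _))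
    congr 1
    have h4 := evalGL_comp_restrict r R S (rightGL (R := R) S V)
    have h5 := comp_evalGL (Algebra.TensorProduct.includeRight : B →ₐ[R] S ⊗[R] B) V
    ext x
    exact DFunLike.congr_fun (h5.trans h4.symm) x
  · exact (Over.w _).trans (Over.w _).symm

end BaseChange

end Affine

/-! ### Invariants of a simple difference ring -/

section Difference

/-- The ring `A` with the endomorphism `s` is simple as a difference ring, that is, it has no
`s`-stable ideals but `0` and `A`, and its ring of `s`-invariants is `F`. -/
structure IsSimpleDifferenceRing (F : Type*) {A : Type*} [CommRing F] [CommRing A] [Algebra F A]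
    (s : A →+* A) : Prop where
  fixed : ∀ x, s x = x ↔ x ∈ Set.range (algebraMap F A)
  eq_bot_or_eq_top : ∀ I : Ideal A, (∀ x ∈ I, s x ∈ I) → I = ⊥ ∨ I = ⊤

namespace IsSimpleDifferenceRing

variable {F A : Type*} [Field F] [CommRing A] [Algebra F A] {s : A →+* A}

/-- A nonzero submodule of `A ^ n` that is stable under `s` contains a nonzero vector with entries
in the field of invariants: take a nonzero vector of minimal support; by simplicity one of its
entries may be taken to be `1`, and then `s` fixes it by minimality. -/
theorem exists_invariant_mem (hs : IsSimpleDifferenceRing F s) {n : Type*} [Fintype n]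
    (N : Submodule A (n → A)) (hN : ∀ x ∈ N, (fun i => s (x i)) ∈ N) (hne : N ≠ ⊥) :
    ∃ c : n → F, c ≠ 0 ∧ (fun i => algebraMap F A (c i)) ∈ N := by
  classical
  obtain ⟨x₀, hx₀, hx₀'⟩ := (Submodule.ne_bot_iff N).1 hne
  obtain ⟨x, ⟨hxN, hx⟩, hmin⟩ := (measure fun x : n → A => Finset.card {i | x i ≠ 0}).wf.has_min
    {x | x ∈ N ∧ x ≠ 0} ⟨x₀, hx₀, hx₀'⟩
  obtain ⟨i, hi⟩ := Function.ne_iff.1 hx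
  let N' : Submodule A (n → A) :=
    { carrier := {y | y ∈ N ∧ ∀ j, x j = 0 → y j = 0}
      zero_mem' := ⟨N.zero_mem, fun _ _ => rfl⟩
      add_mem' := fun {y z} hy hz =>
        ⟨N.add_mem hy.1 hz.1, fun j hj => by simp [hy.2 j hj, hz.2 j hj]⟩
      smul_mem' := fun a y hy => ⟨N.smul_mem a hy.1, fun j hj => by simp [hy.2 j hj]⟩ }
  have hN' : ∀ y ∈ N', (fun i => s (y i)) ∈ N' := fun y hy =>
    ⟨hN y hy.1, fun j hj => by simp [hy.2 j hj]⟩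
  have htop : Submodule.map (LinearMap.proj i) N' = (⊤ : Ideal A) := by
    refine (hs.eq_bot_or_eq_top (Submodule.map (LinearMap.proj i) N') ?_).resolve_left ?_
    · rintro _ ⟨y, hy, rfl⟩
      exact ⟨_, hN' y hy, rfl⟩
    · intro h
      have : x i ∈ Submodule.map (LinearMap.proj i) N' := ⟨x, ⟨hxN, fun _ h => h⟩, rfl⟩
      rw [h] at this
      exact hi this
  obtain ⟨y, hy, hyi⟩ : (1 : A) ∈ Submodule.map (LinearMap.proj i) N' := htop ▸ Submodule.mem_top
  have hyi : y i = 1 := hyi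
  have hz : (fun j => s (y j)) - y = 0 := by
    by_contra hz
    have hzN : (fun j => s (y j)) - y ∈ N' := N'.sub_mem (hN' y hy) hy
    refine hmin _ ⟨hzN.1, hz⟩ (Finset.card_lt_card ?_)
    refine Finset.ssubset_iff_subset_ne.2 ⟨fun j hj => ?_, fun h => ?_⟩
    · simp only [Finset.mem_filter_univ] at hj ⊢
      exact fun h => hj (hzN.2 j h)
    · have : i ∈ Finset.univ.filter fun j => x j ≠ 0 := by simpa using hi
      rw [← h] at this
      simp [hyi] at this
  have hfix : ∀ j, ∃ c, algebraMap F A c = y j := fun j =>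
    (hs.fixed _).1 (sub_eq_zero.1 (congrFun hz j))
  choose c hc using hfix
  refine ⟨c, fun h => hi ?_, ?_⟩
  · have h1 : (1 : A) = 0 := by rw [← hyi, ← hc i, h, Pi.zero_apply, map_zero]
    rw [← one_mul (x i), h1, zero_mul, Pi.zero_apply]
  · rw [funext hc]
    exact hy.1

theorem linearIndependent (hs : IsSimpleDifferenceRing F s) {V : Type*} [AddCommGroup V]
    [Module A V] [Module F V] [IsScalarTower F A V] (τ : V →+ V)
    (hτ : ∀ (a : A) (v : V), τ (a • v) = s a • τ v) {n : Type*} {v : n → V}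
    (hv : ∀ i, τ (v i) = v i) (h : LinearIndependent F v) : LinearIndependent A v := by
  rw [linearIndependent_iff_finset_linearIndependent] at h ⊢
  intro t
  specialize h t
  rw [Fintype.linearIndependent_iff] at h
  by_contra hne
  rw [Fintype.linearIndependent_iff] at hne
  push Not at hne
  obtain ⟨g, hg, i, hi⟩ := hne
  obtain ⟨c, hc, hcN⟩ := hs.exists_invariant_mem
    (LinearMap.ker (Fintype.linearCombination A (v ∘ ((↑) : t → n))))
    (fun x hx => by
      rw [LinearMap.mem_ker, Fintype.linearCombination_apply] at hx ⊢
      have := congrArg τ hx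
      simpa [map_sum, hτ, hv] using this)
    ((Submodule.ne_bot_iff _).2 ⟨g, hg, fun h => hi (congrFun h i)⟩)
  refine hc (funext (h c ?_))
  rw [LinearMap.mem_ker, Fintype.linearCombination_apply] at hcN
  simpa using hcN

/-- Invariants that are linearly independent over `F` remain so over `A`. -/
theorem injective_liftBaseChange (hs : IsSimpleDifferenceRing F s) {V W : Type*} [AddCommGroup V]
    [Module A V] [Module F V] [IsScalarTower F A V] [AddCommGroup W] [Module F W] (τ : V →+ V)
    (hτ : ∀ (a : A) (v : V), τ (a • v) = s a • τ v) (q : W →ₗ[F] V) (hq : Function.Injective q)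
    (hfix : ∀ w, τ (q w) = q w) : Function.Injective (q.liftBaseChange A) := by
  let b := Module.Basis.ofVectorSpace F W
  have h1 : LinearIndependent F (q ∘ b) := b.linearIndependent.map' q (LinearMap.ker_eq_bot.2 hq)
  have h2 : LinearIndependent A (q ∘ b) := hs.linearIndependent τ hτ (fun i => hfix (b i)) h1
  have h3 : (q.liftBaseChange A) ∘ (b.baseChange A) = q ∘ b := by
    ext i
    simp
  rw [injective_iff_map_eq_zero]
  intro t ht
  rw [← (b.baseChange A).linearCombination_repr t, Finsupp.apply_linearCombination, h3] at ht
  have h4 := (linearIndependent_iff.1 h2) _ ht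
  rwa [EmbeddingLike.map_eq_zero_iff] at h4

end IsSimpleDifferenceRing

end Difference

/-! ### Quotients of fundamental matrices -/

section Quotients

variable {r : ℕ} {F E : Type u} [Field F] [Field E] [Algebra F E]

/-- The homomorphism `s : A → A'` is `F`-linear, it is semilinear over the endomorphism `sE` of `E`,
and it maps the invertible matrix `M` to `Φ M'`. -/
structure IsTwistedMap (F : Type u) {E : Type u} [Field F] [Field E] [Algebra F E]
    (sE : E →+* E) (Φ : GL (Fin r) E) {A A' : Type v} [CommRing A] [Algebra E A] [Algebra F A]
    [CommRing A'] [Algebra E A'] [Algebra F A'] (s : A →+* A') (M : GL (Fin r) A)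
    (M' : GL (Fin r) A') : Prop where
  map_const : ∀ x, s (algebraMap F A x) = algebraMap F A' x
  map_base : ∀ x, s (algebraMap E A x) = algebraMap E A' (sE x)
  map_matrix : Matrix.GeneralLinearGroup.map s M =
    Matrix.GeneralLinearGroup.map (algebraMap E A') Φ * M'

/-- `M` is a fundamental matrix for `Φ` over the `E`-algebra `A` with an endomorphism `s` that
extends `sE`, where `A` is simple as a difference ring and has the invariants `F`. -/
structure IsSimpleSolution (F : Type u) {E : Type u} [Field F] [Field E] [Algebra F E]
    (sE : E →+* E) (Φ : GL (Fin r) E) {A : Type v} [CommRing A] [Algebra E A] [Algebra F A]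
    (s : A →+* A) (M : GL (Fin r) A) : Prop extends IsTwistedMap F sE Φ s M M where
  isSimple : IsSimpleDifferenceRing F s

theorem generalLinearGroup_map_map {A B C : Type*} [CommRing A] [CommRing B] [CommRing C]
    (g : B →+* C) (f : A →+* B) (M : GL (Fin r) A) :
    Matrix.GeneralLinearGroup.map g (Matrix.GeneralLinearGroup.map f M) =
      Matrix.GeneralLinearGroup.map (g.comp f) M := by
  ext i j
  rfl

section Tensor

variable {A B C : Type v} [CommRing A] [CommRing B] [CommRing C] [Algebra E A] [Algebra E B]
  [Algebra E C]

theorem mapGL_tensorQuotient {D : Type*} [CommRing D] [Algebra E D] (g : A ⊗[E] B →ₐ[E] D)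
    (M : GL (Fin r) A) (N : GL (Fin r) B) :
    mapGL E g (tensorQuotient E M N) =
      (mapGL E (g.comp Algebra.TensorProduct.includeLeft) M)⁻¹ *
        mapGL E (g.comp Algebra.TensorProduct.includeRight) N := by
  rw [tensorQuotient, map_mul, map_inv, mapGL_mapGL, mapGL_mapGL]

/-- The universal property of `A ⊗ B` for ring homomorphisms that agree on `E` without being
`E`-linear, as is the case for semilinear ones. -/
theorem exists_ringHom_tensorProduct {D : Type*} [CommRing D] (f : A →+* D) (g : B →+* D)
    (h : f.comp (algebraMap E A) = g.comp (algebraMap E B)) :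
    ∃ t : A ⊗[E] B →+* D, ∀ a b, t (a ⊗ₜ b) = f a * g b := by
  let : Algebra E D := (f.comp (algebraMap E A)).toAlgebra
  let f' : A →ₐ[E] D := { f with commutes' := fun _ => rfl }
  let g' : B →ₐ[E] D := { g with commutes' := fun x => (congrArg (fun φ => φ x) h).symm }
  exact ⟨(Algebra.TensorProduct.lift f' g' fun _ _ => Commute.all _ _).toRingHom,
    fun a b => Algebra.TensorProduct.lift_tmul f' g' (fun _ _ => Commute.all _ _) a b⟩

variable [Algebra F A] [Algebra F B] [IsScalarTower F E A]

/-- The tensor product of two twisted maps for the same `Φ` sends `M⁻¹ ⊗ N` to `M'⁻¹ ⊗ N'`, because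
`Φ` cancels. -/
theorem exists_map_tensorQuotient {A' B' : Type v} [CommRing A'] [CommRing B'] [Algebra E A']
    [Algebra E B'] [Algebra F A'] [Algebra F B'] [IsScalarTower F E A'] {M : GL (Fin r) A}
    {N : GL (Fin r) B} {M' : GL (Fin r) A'} {N' : GL (Fin r) B'} {sE : E →+* E} {Φ : GL (Fin r) E}
    {s : A →+* A'} {t : B →+* B'} (hM : IsTwistedMap F sE Φ s M M')
    (hN : IsTwistedMap F sE Φ t N N') :
    ∃ τ : A ⊗[E] B →ₐ[F] A' ⊗[E] B', (∀ a b, τ (a ⊗ₜ b) = s a ⊗ₜ t b) ∧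
      mapGL F τ (tensorQuotient E M N) = tensorQuotient E M' N' := by
  let jA : A' →+* A' ⊗[E] B' := (Algebra.TensorProduct.includeLeft : A' →ₐ[E] A' ⊗[E] B').toRingHom
  let jB : B' →+* A' ⊗[E] B' :=
    (Algebra.TensorProduct.includeRight : B' →ₐ[E] A' ⊗[E] B').toRingHom
  have hj : jA.comp (algebraMap E A') = jB.comp (algebraMap E B') := by
    ext x
    change algebraMap E A' x ⊗ₜ[E] (1 : B') = (1 : A') ⊗ₜ[E] algebraMap E B' x
    rw [Algebra.algebraMap_eq_smul_one, Algebra.algebraMap_eq_smul_one, TensorProduct.smul_tmul]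
  obtain ⟨τ, hτ⟩ := exists_ringHom_tensorProduct (E := E) (jA.comp s) (jB.comp t) (by
    ext x
    change jA (s (algebraMap E A x)) = jB (t (algebraMap E B x))
    rw [hM.map_base, hN.map_base]
    exact DFunLike.congr_fun hj (sE x))
  have hτ' : ∀ a b, τ (a ⊗ₜ b) = s a ⊗ₜ t b := fun a b => by
    rw [hτ]
    change (s a ⊗ₜ[E] (1 : B')) * ((1 : A') ⊗ₜ[E] t b) = _
    rw [Algebra.TensorProduct.tmul_mul_tmul, mul_one, one_mul]
  refine ⟨{ τ with commutes' := fun c => ?_ }, hτ', ?_⟩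
  · change τ (algebraMap F A c ⊗ₜ[E] (1 : B)) = algebraMap F A' c ⊗ₜ[E] (1 : B')
    rw [hτ', hM.map_const, map_one]
  · change Matrix.GeneralLinearGroup.map τ (_⁻¹ * _) = _
    let iA : A →+* A ⊗[E] B := (Algebra.TensorProduct.includeLeft : A →ₐ[E] A ⊗[E] B).toRingHom
    let iB : B →+* A ⊗[E] B := (Algebra.TensorProduct.includeRight : B →ₐ[E] A ⊗[E] B).toRingHom
    have hA : τ.comp iA = jA.comp s := by
      ext a
      change τ (a ⊗ₜ 1) = s a ⊗ₜ 1
      rw [hτ', map_one]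
    have hB : τ.comp iB = jB.comp t := by
      ext b
      change τ (1 ⊗ₜ b) = 1 ⊗ₜ t b
      rw [hτ', map_one]
    have h1 : Matrix.GeneralLinearGroup.map τ (Matrix.GeneralLinearGroup.map iA M) =
        Matrix.GeneralLinearGroup.map (jA.comp (algebraMap E A')) Φ *
          Matrix.GeneralLinearGroup.map jA M' := by
      rw [generalLinearGroup_map_map, hA, ← generalLinearGroup_map_map, hM.map_matrix, map_mul,
        generalLinearGroup_map_map]
    have h2 : Matrix.GeneralLinearGroup.map τ (Matrix.GeneralLinearGroup.map iB N) =
        Matrix.GeneralLinearGroup.map (jA.comp (algebraMap E A')) Φ *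
          Matrix.GeneralLinearGroup.map jB N' := by
      rw [generalLinearGroup_map_map, hB, ← generalLinearGroup_map_map, hN.map_matrix, map_mul,
        generalLinearGroup_map_map, hj]
    rw [map_mul, map_inv]
    refine (congrArg₂ (fun x y => x⁻¹ * y) h1 h2).trans ?_
    rw [mul_inv_rev, mul_assoc, inv_mul_cancel_left]
    rfl

/-- Regular functions of `M⁻¹ ⊗ N` are invariants of `A ⊗ B`, so scalars in `F` and in `A` extend
in the same way. -/
theorem injective_liftBaseChange_tensorQuotient {M : GL (Fin r) A} {N : GL (Fin r) B}
    {sE : E →+* E} {Φ : GL (Fin r) E} {s : A →+* A} {t : B →+* B}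
    (hM : IsSimpleSolution F sE Φ s M) (hN : IsSimpleSolution F sE Φ t N)
    {Q : Type w} [CommRing Q] [Algebra F Q] {V : GL (Fin r) Q}
    (hV : ∀ g h : Q →ₐ[F] A ⊗[E] B, mapGL F g V = mapGL F h V → g = h)
    (q : Q →ₐ[F] A ⊗[E] B) (hq : Function.Injective q) (hqV : mapGL F q V = tensorQuotient E M N) :
    Function.Injective (q.toLinearMap.liftBaseChange A) := by
  obtain ⟨τ, hτ, hτQ⟩ := exists_map_tensorQuotient hM.toIsTwistedMap
    hN.toIsTwistedMap
  have hfix : τ.comp q = q := hV _ _ (by rw [← mapGL_mapGL, hqV, hτQ])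
  refine hM.isSimple.injective_liftBaseChange (τ : A ⊗[E] B →+ A ⊗[E] B) (fun a v => ?_) _ hq
    (fun w => DFunLike.congr_fun hfix w)
  induction v with
  | zero => simp
  | add x y hx hy => rw [smul_add, map_add, hx, hy, map_add, smul_add]
  | tmul x y =>
    change τ (a • (x ⊗ₜ y)) = s a • τ (x ⊗ₜ y)
    rw [TensorProduct.smul_tmul', hτ, hτ, TensorProduct.smul_tmul', smul_eq_mul, smul_eq_mul,
      map_mul]

variable [Algebra F C] [IsScalarTower F E B]

/-- The equations of `M⁻¹ ⊗ O` hold for the product of `M⁻¹ ⊗ N` and `N⁻¹ ⊗ O` even when the two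
factors are made independent over `F`: this independence already holds in `A ⊗ B ⊗ C`, where the
product is `M⁻¹ ⊗ 1 ⊗ O`. -/
theorem evalGL_leftGL_mul_rightGL {M : GL (Fin r) A} {N : GL (Fin r) B} {O : GL (Fin r) C}
    {sE : E →+* E} {Φ : GL (Fin r) E} {s : B →+* B} {t : C →+* C}
    (hN : IsSimpleSolution F sE Φ s N) (hO : IsSimpleSolution F sE Φ t O)
    {P : Type w} [CommRing P] [Algebra F P] {U : GL (Fin r) P}
    (p : P →ₐ[F] A ⊗[E] B) (hp : Function.Injective p) (hpU : mapGL F p U = tensorQuotient E M N)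
    {Q : Type w} [CommRing Q] [Algebra F Q] {V : GL (Fin r) Q}
    (hV : ∀ g h : Q →ₐ[F] B ⊗[E] C, mapGL F g V = mapGL F h V → g = h)
    (q : Q →ₐ[F] B ⊗[E] C) (hq : Function.Injective q) (hqV : mapGL F q V = tensorQuotient E N O)
    {f : GLCoord r F} (hf : evalGL F (tensorQuotient E M O) f = 0) :
    evalGL F (leftGL (R := F) Q U * rightGL (R := F) P V) f = 0 := by
  let β : B ⊗[F] Q →ₗ[B] B ⊗[E] C := q.toLinearMap.liftBaseChange B
  have hβ : Function.Injective β := injective_liftBaseChange_tensorQuotient hN hO hV q hq hqV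
  let i₁₂ : A ⊗[E] B →ₐ[E] A ⊗[E] (B ⊗[E] C) :=
    Algebra.TensorProduct.map (.id E A) Algebra.TensorProduct.includeLeft
  let i₁₃ : A ⊗[E] C →ₐ[E] A ⊗[E] (B ⊗[E] C) :=
    Algebra.TensorProduct.map (.id E A) Algebra.TensorProduct.includeRight
  let i₂₃ : B ⊗[E] C →ₐ[E] A ⊗[E] (B ⊗[E] C) := Algebra.TensorProduct.includeRight
  let θ : P ⊗[F] Q →ₐ[F] A ⊗[E] (B ⊗[E] C) :=
    Algebra.TensorProduct.lift ((i₁₂.restrictScalars F).comp p) ((i₂₃.restrictScalars F).comp q)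
      fun _ _ => Commute.all _ _
  have hθ : ∀ x, θ x = LinearMap.lTensor A (β.restrictScalars E)
      (TensorProduct.AlgebraTensorModule.assoc F E E A B Q
        (LinearMap.rTensor Q p.toLinearMap x)) := by
    intro x
    induction x with
    | zero => simp
    | add x y hx hy => simp only [map_add, hx, hy]
    | tmul x y =>
      rw [Algebra.TensorProduct.lift_tmul, LinearMap.rTensor_tmul]
      change i₁₂ (p x) * i₂₃ (q y) = LinearMap.lTensor A (β.restrictScalars E)
        (TensorProduct.AlgebraTensorModule.assoc F E E A B Q (p x ⊗ₜ y))
      induction p x with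
      | zero => simp
      | add x y hx hy => simp only [map_add, add_mul, TensorProduct.add_tmul, hx, hy]
      | tmul a b =>
        rw [TensorProduct.AlgebraTensorModule.assoc_tmul, LinearMap.lTensor_tmul]
        change (a ⊗ₜ[E] (b ⊗ₜ[E] (1 : C))) * ((1 : A) ⊗ₜ[E] q y) = a ⊗ₜ[E] β (b ⊗ₜ y)
        rw [LinearMap.liftBaseChange_tmul, Algebra.TensorProduct.tmul_mul_tmul, mul_one]
        congr 1
        exact (Algebra.smul_def b (q y)).symm
  have hinj : Function.Injective θ := by
    have hβ' : Function.Injective (LinearMap.lTensor A (β.restrictScalars E)) :=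
      Module.Flat.lTensor_preserves_injective_linearMap (β.restrictScalars E) hβ
    have hp' : Function.Injective (LinearMap.rTensor Q p.toLinearMap) :=
      Module.Flat.rTensor_preserves_injective_linearMap p.toLinearMap hp
    intro x y hxy
    rw [hθ, hθ] at hxy
    exact hp' ((TensorProduct.AlgebraTensorModule.assoc F E E A B Q).injective (hβ' hxy))
  refine evalGL_eq_zero_of_injective θ hinj ?_
  have h₁ : i₁₂.comp Algebra.TensorProduct.includeLeft =
      i₁₃.comp Algebra.TensorProduct.includeLeft := by
    ext a; rfl
  have h₂ : i₁₂.comp Algebra.TensorProduct.includeRight =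
      i₂₃.comp Algebra.TensorProduct.includeLeft := by
    ext b; rfl
  have h₃ : i₁₃.comp Algebra.TensorProduct.includeRight =
      i₂₃.comp Algebra.TensorProduct.includeRight := by
    ext c; rfl
  have h : mapGL F θ (leftGL (R := F) Q U * rightGL (R := F) P V) =
      mapGL F (i₁₃.restrictScalars F) (tensorQuotient E M O) := by
    have hR : θ.comp Algebra.TensorProduct.includeRight = (i₂₃.restrictScalars F).comp q :=
      Algebra.TensorProduct.lift_comp_includeRight _ _ fun _ _ => Commute.all _ _
    rw [map_mul, mapGL_mapGL, mapGL_mapGL, Algebra.TensorProduct.lift_comp_includeLeft, hR,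
      ← mapGL_mapGL, ← mapGL_mapGL, hpU, hqV]
    refine (congrArg₂ (· * ·) (mapGL_tensorQuotient i₁₂ M N) (mapGL_tensorQuotient i₂₃ N O)).trans
      (Eq.trans ?_ (mapGL_tensorQuotient i₁₃ M O).symm)
    rw [h₁, h₂, h₃]
    group
  rw [h]
  exact evalGL_mapGL_eq_zero _ hf

/-- The equations of `M` hold for the product of `M` and `M⁻¹ ⊗ M` even when the two factors are
made independent over `E`: this independence already holds in `A ⊗ A`, where the product is
`1 ⊗ M`. -/
theorem evalGL_leftGL_mul_rightGL_baseChange {M : GL (Fin r) A}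
    {sE : E →+* E} {Φ : GL (Fin r) E} {s : A →+* A} (hM : IsSimpleSolution F sE Φ s M)
    {P : Type w} [CommRing P] [Algebra E P] {U : GL (Fin r) P}
    (p : P →ₐ[E] A) (hp : Function.Injective p) (hpU : mapGL E p U = M)
    {Q : Type u} [CommRing Q] [Algebra F Q] {V : GL (Fin r) Q}
    (hV : ∀ g h : Q →ₐ[F] A ⊗[E] A, mapGL F g V = mapGL F h V → g = h)
    (q : Q →ₐ[F] A ⊗[E] A) (hq : Function.Injective q) (hqV : mapGL F q V = tensorQuotient E M M)
    {f : GLCoord r E} (hf : evalGL E M f = 0) :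
    evalGL E (leftGL (R := E) (E ⊗[F] Q) U * rightGL (R := E) P (rightGL (R := F) E V)) f = 0 := by
  let β : A ⊗[F] Q →ₗ[A] A ⊗[E] A := q.toLinearMap.liftBaseChange A
  have hβ : Function.Injective β := injective_liftBaseChange_tensorQuotient hM hM hV q hq hqV
  let iL : A →ₐ[E] A ⊗[E] A := Algebra.TensorProduct.includeLeft
  let iR : A →ₐ[E] A ⊗[E] A := Algebra.TensorProduct.includeRight
  let q' : E ⊗[F] Q →ₐ[E] A ⊗[E] A :=
    Algebra.TensorProduct.lift (Algebra.ofId E _) q fun _ _ => Commute.all _ _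
  let θ : P ⊗[E] (E ⊗[F] Q) →ₐ[E] A ⊗[E] A :=
    Algebra.TensorProduct.lift (iL.comp p) q' fun _ _ => Commute.all _ _
  have hθ : ∀ x, θ x = β (TensorProduct.AlgebraTensorModule.cancelBaseChange F E E A Q
        (LinearMap.rTensor (E ⊗[F] Q) p.toLinearMap x)) := by
    intro x
    induction x with
    | zero => simp
    | add x y hx hy => simp only [map_add, hx, hy]
    | tmul x y =>
      rw [Algebra.TensorProduct.lift_tmul, LinearMap.rTensor_tmul]
      change iL (p x) * q' y =
        β (TensorProduct.AlgebraTensorModule.cancelBaseChange F E E A Q (p x ⊗ₜ y))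
      induction y with
      | zero => simp
      | add x y hx hy => simp only [map_add, mul_add, TensorProduct.tmul_add, hx, hy]
      | tmul e y =>
        rw [TensorProduct.AlgebraTensorModule.cancelBaseChange_tmul, LinearMap.liftBaseChange_tmul,
          Algebra.TensorProduct.lift_tmul]
        change iL (p x) * (algebraMap E _ e * q y) = _
        rw [Algebra.smul_def, ← mul_assoc, mul_comm (iL _), Algebra.smul_def e, map_mul]
        rfl
  have hinj : Function.Injective θ := by
    rw [show ⇑θ = _ from funext hθ]
    exact hβ.comp
      ((LinearEquiv.injective _).comp (Module.Flat.rTensor_preserves_injective_linearMap _ hp))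
  refine evalGL_eq_zero_of_injective θ hinj ?_
  have h : mapGL E θ (leftGL (R := E) (E ⊗[F] Q) U * rightGL (R := E) P (rightGL (R := F) E V)) =
      mapGL E iR M := by
    have h1 : mapGL E q' (rightGL (R := F) E V) = tensorQuotient E M M := by
      rw [← hqV]
      refine (mapGL_mapGL (R := F) (q'.restrictScalars F) Algebra.TensorProduct.includeRight
        V).trans ?_
      congr 2
      ext y
      change algebraMap E _ 1 * q y = q y
      rw [map_one, one_mul]
    have h2 : θ.comp Algebra.TensorProduct.includeRight = q' :=
      Algebra.TensorProduct.lift_comp_includeRight _ _ fun _ _ => Commute.all _ _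
    rw [map_mul, mapGL_mapGL, mapGL_mapGL, Algebra.TensorProduct.lift_comp_includeLeft, h2,
      ← mapGL_mapGL, hpU, h1, tensorQuotient, mul_inv_cancel_left]
  rw [h]
  exact evalGL_mapGL_eq_zero _ hf

end Tensor

end Quotients

/-! ### The torsors attached to fundamental matrices -/

section QuotientTorsors

variable {r : ℕ}

theorem quotient_algHom_ext {R : Type u} [CommRing R] {I : Ideal (GLCoord r R)} {D : Type v}
    [CommRing D] [Algebra R D] {g h : (GLCoord r R ⧸ I) →ₐ[R] D}
    (hgh : mapGL R g (quotientMatrix I) = mapGL R h (quotientMatrix I)) : g = h := by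
  apply Ideal.Quotient.algHom_ext
  apply algHom_ext_GL
  rwa [quotientMatrix, mapGL_mapGL, mapGL_mapGL] at hgh

theorem exists_injective_mapGL_quotientMatrix {R : Type u} [CommRing R] {D : Type v} [CommRing D]
    [Algebra R D] (M : GL (Fin r) D) {I : Ideal (GLCoord r R)}
    (hI : I = RingHom.ker (evalGL R M)) :
    ∃ p : (GLCoord r R ⧸ I) →ₐ[R] D,
      Function.Injective p ∧ mapGL R p (quotientMatrix I) = M := by
  subst hI
  refine ⟨Ideal.kerLiftAlg (evalGL R M), Ideal.kerLiftAlg_injective _, ?_⟩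
  rw [quotientMatrix, mapGL_mapGL]
  exact evalGL_genericMatrix M

variable {F E : Type u} [Field F] [Field E] [Algebra F E]
variable {A B : Type v} [CommRing A] [CommRing B] [Algebra E A] [Algebra E B] [Algebra F A]
  [IsScalarTower F E A]

variable (F E) in
/-- The ideal of all relations over `F` between the entries of `M⁻¹ ⊗ N`. -/
abbrev quotientIdeal (M : GL (Fin r) A) (N : GL (Fin r) B) : Ideal (GLCoord r F) :=
  RingHom.ker (evalGL F (tensorQuotient E M N))

theorem quotientIdeal_ne_top [Nontrivial A] [Nontrivial B] {M : GL (Fin r) A} {N : GL (Fin r) B} :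
    quotientIdeal F E M N ≠ ⊤ := by
  have : Nontrivial (A ⊗[E] B) :=
    Algebra.TensorProduct.nontrivial_of_algebraMap_injective_of_flat_left E A B
      (algebraMap E B).injective
  exact RingHom.ker_ne_top _

variable [Algebra F B] [IsScalarTower F E B]
variable {M : GL (Fin r) A} {N : GL (Fin r) B} {sE : E →+* E} {Φ : GL (Fin r) E} {s : A →+* A}
  {t : B →+* B}

variable (F E M N) in
theorem exists_swap : ∃ c : A ⊗[E] B →ₐ[F] B ⊗[E] A, Function.Injective c ∧
    mapGL F c (tensorQuotient E M N)⁻¹ = tensorQuotient E N M := by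
  refine ⟨(Algebra.TensorProduct.comm E A B).toAlgHom.restrictScalars F,
    (Algebra.TensorProduct.comm E A B).injective, ?_⟩
  have h := mapGL_tensorQuotient (Algebra.TensorProduct.comm E A B).toAlgHom M N
  have h₁ : (Algebra.TensorProduct.comm E A B).toAlgHom.comp Algebra.TensorProduct.includeLeft =
      Algebra.TensorProduct.includeRight := by
    ext; rfl
  have h₂ : (Algebra.TensorProduct.comm E A B).toAlgHom.comp Algebra.TensorProduct.includeRight =
      Algebra.TensorProduct.includeLeft := by
    ext; rfl
  rw [h₁, h₂] at h
  rw [map_inv]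
  refine (congrArg _ h).trans ?_
  rw [mul_inv_rev, inv_inv, tensorQuotient]

variable (F E M N) in
/-- The inverse of the universal point of `M⁻¹ ⊗ N` is a point of `N⁻¹ ⊗ M`. -/
theorem exists_injective_mapGL_inv :
    ∃ p : (GLCoord r F ⧸ quotientIdeal F E M N) →ₐ[F] B ⊗[E] A, Function.Injective p ∧
      mapGL F p (quotientMatrix _)⁻¹ = tensorQuotient E N M := by
  obtain ⟨c, hc, hcM⟩ := exists_swap F E M N
  obtain ⟨p, hp, hpM⟩ := exists_injective_mapGL_quotientMatrix (tensorQuotient E M N)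
    (I := quotientIdeal F E M N) rfl
  exact ⟨c.comp p, hc.comp hp, by rw [← mapGL_mapGL, map_inv, hpM, hcM]⟩

theorem quotient_algHom_ext_inv {D : Type v} [CommRing D] [Algebra F D] {I : Ideal (GLCoord r F)}
    (g h : (GLCoord r F ⧸ I) →ₐ[F] D)
    (hgh : mapGL F g (quotientMatrix I)⁻¹ = mapGL F h (quotientMatrix I)⁻¹) : g = h := by
  rw [map_inv, map_inv, inv_inj] at hgh
  exact quotient_algHom_ext hgh

theorem exists_isClosedSubgroupScheme_quotientIdeal [Nontrivial A]
    (hM : IsSimpleSolution F sE Φ s M) :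
    ∃ _ : GrpObj (closedSub (quotientIdeal F E M M)),
      IsClosedSubgroupScheme (closedSubι (quotientIdeal F E M M)) := by
  obtain ⟨p, hp, hpM⟩ := exists_injective_mapGL_quotientMatrix (tensorQuotient E M M)
    (I := quotientIdeal F E M M) rfl
  refine exists_isClosedSubgroupScheme _ (fun f hf => ?_) (fun f hf => ?_) (fun f hf => ?_)
  · -- The diagonal `A ⊗ A → A` sends `M⁻¹ ⊗ M` to the unit matrix.
    let δ : A ⊗[E] A →ₐ[E] A := Algebra.TensorProduct.lmul' E
    have hδ : mapGL F (δ.restrictScalars F) (tensorQuotient E M M) = 1 := by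
      refine (mapGL_tensorQuotient δ M M).trans ?_
      rw [Algebra.TensorProduct.lmul'_comp_includeLeft,
        Algebra.TensorProduct.lmul'_comp_includeRight, inv_mul_cancel]
    refine evalGL_eq_zero_of_injective (Algebra.ofId F A) (algebraMap F A).injective ?_
    rw [map_one, ← hδ]
    exact evalGL_mapGL_eq_zero _ hf
  · exact evalGL_leftGL_mul_rightGL hM hM p hp hpM (fun _ _ => quotient_algHom_ext) p hp hpM hf
  · obtain ⟨q, hq, hqM⟩ := exists_injective_mapGL_inv F E M M
    refine evalGL_eq_zero_of_injective q hq ?_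
    rw [hqM]
    exact hf

/-- `M⁻¹ ⊗ N` defines a right torsor under the group of `N⁻¹ ⊗ N`. -/
theorem isRightTorsorIn_quotientIdeal [Nontrivial A] [Nontrivial B]
    (hM : IsSimpleSolution F sE Φ s M) (hN : IsSimpleSolution F sE Φ t N)
    {J : Ideal (GLCoord r F)} (hJ : J = quotientIdeal F E N N) [GrpObj (closedSub J)]
    [IsMonHom (closedSubι J)] :
    IsRightTorsorIn (closedSubι (quotientIdeal F E M N)) (closedSubι J) := by
  obtain ⟨p, hp, hpM⟩ := exists_injective_mapGL_quotientMatrix (tensorQuotient E M N)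
    (I := quotientIdeal F E M N) rfl
  obtain ⟨q, hq, hqM⟩ := exists_injective_mapGL_quotientMatrix (tensorQuotient E N N) hJ
  obtain ⟨p', hp', hpM'⟩ := exists_injective_mapGL_inv F E M N
  refine isRightTorsorIn_closedSub quotientIdeal_ne_top (fun f hf => ?_) (fun f hf => ?_)
  · exact evalGL_leftGL_mul_rightGL hN hN p hp hpM (fun _ _ => quotient_algHom_ext) q hq hqM hf
  · subst hJ
    rw [← map_inv]
    exact evalGL_leftGL_mul_rightGL hM hN p' hp' hpM' (fun _ _ => quotient_algHom_ext) p hp hpM hf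

/-- `M⁻¹ ⊗ N` defines a left torsor under the group of `M⁻¹ ⊗ M`. -/
theorem isLeftTorsorIn_quotientIdeal [Nontrivial A] [Nontrivial B]
    (hM : IsSimpleSolution F sE Φ s M) (hN : IsSimpleSolution F sE Φ t N)
    {J : Ideal (GLCoord r F)} (hJ : J = quotientIdeal F E M M) [GrpObj (closedSub J)]
    [IsMonHom (closedSubι J)] :
    IsLeftTorsorIn (closedSubι (quotientIdeal F E M N)) (closedSubι J) := by
  obtain ⟨p, hp, hpM⟩ := exists_injective_mapGL_quotientMatrix (tensorQuotient E M N)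
    (I := quotientIdeal F E M N) rfl
  obtain ⟨q, hq, hqM⟩ := exists_injective_mapGL_quotientMatrix (tensorQuotient E M M) hJ
  obtain ⟨p', hp', hpM'⟩ := exists_injective_mapGL_inv F E M N
  refine isLeftTorsorIn_closedSub quotientIdeal_ne_top (fun f hf => ?_) (fun f hf => ?_)
  · exact evalGL_leftGL_mul_rightGL hM hN q hq hqM (fun _ _ => quotient_algHom_ext) p hp hpM hf
  · subst hJ
    rw [← map_inv]
    exact evalGL_leftGL_mul_rightGL hN hM p hp hpM quotient_algHom_ext_inv p' hp' hpM' hf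

/-- A point of an `F`-algebra `Q` with values in an `E`-algebra is a point of `E ⊗ Q`. -/
theorem exists_mapGL_rightGL {Q : Type u} [CommRing Q] [Algebra F Q] (g : Q →ₐ[F] A)
    (V : GL (Fin r) Q) :
    ∃ b : E ⊗[F] Q →ₐ[E] A, mapGL E b (rightGL (R := F) E V) = mapGL F g V := by
  let b : E ⊗[F] Q →ₐ[E] A :=
    Algebra.TensorProduct.lift (Algebra.ofId E A) g fun _ _ => Commute.all _ _
  refine ⟨b, ?_⟩
  refine (mapGL_mapGL (R := F) (b.restrictScalars F) Algebra.TensorProduct.includeRight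
    V).trans ?_
  congr 2
  ext y
  change algebraMap E A 1 * g y = g y
  rw [map_one, one_mul]

theorem evalGL_inv_leftGL_mul_rightGL {P : Type w} [CommRing P] [Algebra E P] [Algebra F P]
    [IsScalarTower F E P] {U : GL (Fin r) P} (p : P →ₐ[E] A) (hp : Function.Injective p)
    {f : GLCoord r F} (hf : evalGL F (tensorQuotient E (mapGL E p U) (mapGL E p U)) f = 0) :
    evalGL F (tensorQuotient E U U) f = 0 := by
  let π : P ⊗[E] P →ₐ[E] A ⊗[E] A := Algebra.TensorProduct.map p p
  have hπ : Function.Injective π := TensorProduct.map_injective_of_flat_flat _ _ hp hp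
  refine evalGL_eq_zero_of_injective (π.restrictScalars F) hπ ?_
  have h : mapGL F (π.restrictScalars F) (tensorQuotient E U U) =
      tensorQuotient E (mapGL E p U) (mapGL E p U) := by
    refine (mapGL_tensorQuotient π U U).trans ?_
    rw [Algebra.TensorProduct.map_comp_includeLeft, Algebra.TensorProduct.map_comp_includeRight,
      ← mapGL_mapGL, ← mapGL_mapGL, tensorQuotient]
  rw [h]
  exact hf

/-- The closure of the point `M` over `E` is a right torsor under the base change of the group of
`M⁻¹ ⊗ M`. -/
theorem isRightTorsorIn_ker_evalGL [Nontrivial A] (hM : IsSimpleSolution F sE Φ s M)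
    {J : Ideal (GLCoord r F)} (hJ : J = quotientIdeal F E M M) [GrpObj (closedSub J)]
    [IsMonHom (closedSubι J)] :
    IsRightTorsorIn (closedSubι (RingHom.ker (evalGL E M)) ≫ GLToBaseChange r F E)
      ((baseChange F E).map (closedSubι J)) := by
  obtain ⟨I, hI⟩ : ∃ I, I = RingHom.ker (evalGL E M) := ⟨_, rfl⟩
  have hI' : I ≠ ⊤ := hI ▸ RingHom.ker_ne_top _
  rw [← hI]
  have := isIso_GLToBaseChange r F E
  have := isMonHom_GLToBaseChange r F E
  obtain ⟨p, hp, hpM⟩ := exists_injective_mapGL_quotientMatrix M hI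
  obtain ⟨q, hq, hqM⟩ := exists_injective_mapGL_quotientMatrix (tensorQuotient E M M) hJ
  have hmul : ∀ f ∈ I, evalGL E (leftGL (R := E) (E ⊗[F] (GLCoord r F ⧸ J)) (quotientMatrix I) *
      rightGL (R := E) (GLCoord r E ⧸ I) (rightGL (R := F) E (quotientMatrix J))) f = 0 := by
    intro f hf
    rw [hI] at hf
    exact evalGL_leftGL_mul_rightGL_baseChange hM p hp hpM (fun _ _ => quotient_algHom_ext) q hq
      hqM hf
  obtain ⟨a, ha⟩ := exists_mapGL_quotientMatrix hmul
  have hdiv : ∀ f ∈ J, evalGL F (tensorQuotient E (quotientMatrix I)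
      (quotientMatrix I)) f = 0 := fun f hf => by
    refine evalGL_inv_leftGL_mul_rightGL p hp ?_
    rw [hJ] at hf
    rw [hpM]
    exact hf
  obtain ⟨b₀, hb₀⟩ := exists_mapGL_quotientMatrix hdiv
  obtain ⟨b, hb⟩ := exists_mapGL_rightGL (E := E) b₀ (quotientMatrix J)
  have : Nontrivial (GLCoord r E ⧸ I) := Ideal.Quotient.nontrivial_iff.2 hI'
  have : Mono (pointGL (R := E) (quotientMatrix I)) :=
    closedSubι_eq_pointGL I ▸ mono_closedSubι _
  have : Mono ((baseChange F E).map (closedSubι J)) := inferInstance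
  rw [closedSubι_eq_pointGL I]
  exact isRightTorsorIn_pointGL (GLToBaseChange r F E) ((baseChange F E).map (closedSubι J))
    (asIso (specBaseChange F E _)) (by
      rw [asIso_hom, closedSubι_eq_pointGL, specBaseChange_comp]) a ha b (hb.trans hb₀)

end QuotientTorsors

/-! ### Components of a difference ring that is a product of fields -/

section Components

variable {d : ℕ} {F E : Type u} {L : ZMod d → Type v} [Field F] [Field E] [∀ l, Field (L l)]
  [Algebra F E] [∀ l, Algebra E (L l)] [∀ l, Algebra F (L l)]
  {σ : (∀ l, L l) →+* (∀ l, L l)} {r : ℕ}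

theorem isSimpleDifferenceRing_of_field {K : Type*} [Field K] [Algebra F K] {s : K →+* K}
    (hs : ∀ x, s x = x ↔ x ∈ Set.range (algebraMap F K)) : IsSimpleDifferenceRing F s :=
  ⟨hs, fun I _ => eq_bot_or_eq_top I⟩

theorem IsSigmaAdmissible.pow_algebraMap (hσ : IsSigmaAdmissible F E σ) (k : ℕ) (c : F) :
    (σ ^ k) (algebraMap F (∀ l, L l) c) = algebraMap F (∀ l, L l) c := by
  rw [RingHom.coe_pow]
  exact Function.iterate_fixed ((hσ.fixed _).2 ⟨c, rfl⟩) k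

theorem IsSigmaAdmissible.exists_base (hσ : IsSigmaAdmissible F E σ) :
    ∃ sE : E →+* E, ∀ x, σ (algebraMap E (∀ l, L l) x) = algebraMap E (∀ l, L l) (sE x) := by
  choose f hf using hσ.map_base
  have hinj : Function.Injective (algebraMap E (∀ l, L l)) := (algebraMap E (∀ l, L l)).injective
  exact ⟨{ toFun := f
           map_one' := hinj (by rw [← hf, map_one, map_one])
           map_mul' := fun x y => hinj (by rw [← hf, map_mul, map_mul, map_mul, hf, hf])
           map_zero' := hinj (by rw [← hf, map_zero, map_zero])
           map_add' := fun x y => hinj (by rw [← hf, map_add, map_add, map_add, hf, hf]) }, hf⟩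

theorem pow_algebraMap_base {sE : E →+* E}
    (hE : ∀ x, σ (algebraMap E (∀ l, L l) x) = algebraMap E (∀ l, L l) (sE x)) (k : ℕ) (x : E) :
    (σ ^ k) (algebraMap E (∀ l, L l) x) = algebraMap E (∀ l, L l) ((sE ^ k) x) := by
  induction k with
  | zero => rfl
  | succ k ih => rw [pow_succ', RingHom.mul_def, RingHom.comp_apply, ih, hE, pow_succ']; rfl

theorem exists_map_pow_eq {sE : E →+* E}
    (hE : ∀ x, σ (algebraMap E (∀ l, L l) x) = algebraMap E (∀ l, L l) (sE x))
    {Φ : GL (Fin r) E} {Ψ : GL (Fin r) (∀ l, L l)} (hΨ : IsFundamentalMatrix σ Φ Ψ) (k : ℕ) :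
    ∃ Φ' : GL (Fin r) E, Matrix.GeneralLinearGroup.map (σ ^ k) Ψ =
      Matrix.GeneralLinearGroup.map (algebraMap E (∀ l, L l)) Φ' * Ψ := by
  induction k with
  | zero => exact ⟨1, by rw [map_one, one_mul]; ext; rfl⟩
  | succ k ih =>
    obtain ⟨Φ', h⟩ := ih
    have hE' : σ.comp (algebraMap E (∀ l, L l)) = (algebraMap E (∀ l, L l)).comp sE :=
      RingHom.ext hE
    refine ⟨Matrix.GeneralLinearGroup.map sE Φ' * Φ, ?_⟩
    rw [pow_succ', RingHom.mul_def, ← generalLinearGroup_map_map, h, map_mul,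
      generalLinearGroup_map_map, hE', ← generalLinearGroup_map_map, show
      Matrix.GeneralLinearGroup.map σ Ψ = _ from hΨ, map_mul, mul_assoc]

theorem IsSigmaAdmissible.isTwistedMap_component (hσ : IsSigmaAdmissible F E σ) {l m : ZMod d}
    {k : ℕ} {s : L l →+* L m} (hs : ∀ y : ∀ l, L l, s (y l) = (σ ^ k) y m) {sE : E →+* E}
    (hE : ∀ x, σ (algebraMap E (∀ l, L l) x) = algebraMap E (∀ l, L l) (sE x))
    {Φ : GL (Fin r) E} {Ψ : GL (Fin r) (∀ l, L l)}
    (hΨ : Matrix.GeneralLinearGroup.map (σ ^ k) Ψ =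
      Matrix.GeneralLinearGroup.map (algebraMap E (∀ l, L l)) Φ * Ψ) :
    IsTwistedMap F (sE ^ k) Φ s (component Ψ l) (component Ψ m) where
  map_const x := (hs (algebraMap F (∀ l, L l) x)).trans (congrFun (hσ.pow_algebraMap k x) m)
  map_base x := (hs (algebraMap E (∀ l, L l) x)).trans (congrFun (pow_algebraMap_base hE k x) m)
  map_matrix := by
    have hs' : s.comp (Pi.evalRingHom L l) = (Pi.evalRingHom L m).comp (σ ^ k) := RingHom.ext hs
    rw [component, generalLinearGroup_map_map, hs', ← generalLinearGroup_map_map, hΨ, map_mul,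
      generalLinearGroup_map_map]
    rfl

variable [NeZero d]

theorem IsSigmaAdmissible.apply_eq_zero (hσ : IsSigmaAdmissible F E σ) {y : ∀ l, L l} {l : ZMod d}
    (hy : y l = 0) : σ y (l + 1) = 0 := by
  rw [← Finset.univ_sum_single y, map_sum, Finset.sum_apply]
  refine Finset.sum_eq_zero fun m _ => ?_
  obtain ⟨z, hz⟩ := hσ.map_component m (y m)
  by_cases h : m = l
  · subst h
    rw [hy, Pi.single_zero, map_zero, Pi.zero_apply]
  · rw [hz, Pi.single_eq_of_ne fun h' => h (add_right_cancel h').symm]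

theorem IsSigmaAdmissible.pow_apply_eq_zero (hσ : IsSigmaAdmissible F E σ) {y : ∀ l, L l}
    {l m : ZMod d} {k : ℕ} (h : l + k = m) (hy : y l = 0) : (σ ^ k) y m = 0 := by
  induction k generalizing m with
  | zero =>
    obtain rfl : l = m := by simpa using h
    exact hy
  | succ k ih =>
    obtain rfl : l + k + 1 = m := by rw [← h]; push_cast; ring
    rw [pow_succ', RingHom.mul_def, RingHom.comp_apply]
    exact hσ.apply_eq_zero (ih rfl)

/-- The component at `l + k` of `σ ^ k` depends only on the component at `l` of the argument. -/
theorem IsSigmaAdmissible.pow_apply_congr (hσ : IsSigmaAdmissible F E σ) {y z : ∀ l, L l}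
    {l m : ZMod d} {k : ℕ} (h : l + k = m) (hy : y l = z l) : (σ ^ k) y m = (σ ^ k) z m := by
  have := hσ.pow_apply_eq_zero h (y := y - z) (by rw [Pi.sub_apply, hy, sub_self])
  rwa [map_sub, Pi.sub_apply, sub_eq_zero] at this

/-- For `l + k = m`, the power `σ ^ k` induces a homomorphism from the factor at `l` to the factor
at `m`. -/
theorem IsSigmaAdmissible.exists_component (hσ : IsSigmaAdmissible F E σ) {l m : ZMod d} {k : ℕ}
    (h : l + k = m) : ∃ s : L l →+* L m, ∀ y : ∀ l, L l, s (y l) = (σ ^ k) y m :=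
  ⟨{  toFun := fun x => (σ ^ k) (Pi.single l x) m
      map_one' := by
        rw [hσ.pow_apply_congr h (z := 1) (by simp), map_one, Pi.one_apply]
      map_mul' := fun x y => by rw [Pi.single_mul, map_mul, Pi.mul_apply]
      map_zero' := by rw [Pi.single_zero, map_zero, Pi.zero_apply]
      map_add' := fun x y => by rw [Pi.single_add, map_add, Pi.add_apply] },
    fun y => hσ.pow_apply_congr h (by simp)⟩

/-- An element of `L l` that is fixed by `σ ^ d` is a component of the `σ`-invariant element that
is the sum of its images under `1, σ, …, σ ^ (d - 1)`. -/
theorem IsSigmaAdmissible.mem_range_of_pow_fixed (hσ : IsSigmaAdmissible F E σ) {l : ZMod d}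
    {x : L l} (hx : (σ ^ d) (Pi.single l x) l = x) : x ∈ Set.range (algebraMap F (L l)) := by
  set z : ∀ l, L l := Pi.single l x with hz
  let y : ∀ l, L l := ∑ k ∈ Finset.range d, (σ ^ k) z
  have hzd : (σ ^ d) z = z := by
    funext m
    by_cases h : m = l
    · subst h
      rw [hx, hz, Pi.single_eq_same]
    · have h0 : z m = 0 := Pi.single_eq_of_ne h x
      rw [h0]
      exact hσ.pow_apply_eq_zero (l := m) (by simp) h0
  have hy : σ y = y := by
    have h1 := Finset.sum_range_succ (fun k => (σ ^ k) z) d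
    have h2 := Finset.sum_range_succ' (fun k => (σ ^ k) z) d
    rw [h1, hzd, pow_zero, RingHom.one_def, RingHom.id_apply] at h2
    have h3 := add_right_cancel h2
    rw [map_sum]
    refine Eq.trans (Finset.sum_congr rfl fun k _ => ?_) h3.symm
    rw [pow_succ', RingHom.mul_def, RingHom.comp_apply]
  have hyl : y l = x := by
    refine (Finset.sum_apply l _ _).trans ?_
    rw [Finset.sum_eq_single 0]
    · exact Pi.single_eq_same l x
    · intro k hk hk0
      refine hσ.pow_apply_eq_zero (l := l - k) (by ring) (Pi.single_eq_of_ne (fun h => ?_) x)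
      rw [sub_eq_self, ZMod.natCast_eq_zero_iff] at h
      exact Nat.not_dvd_of_pos_of_lt (Nat.pos_of_ne_zero hk0) (Finset.mem_range.1 hk) h
    · intro h
      exact absurd (Finset.mem_range.2 (NeZero.pos d)) h
  obtain ⟨c, hc⟩ := (hσ.fixed y).1 hy
  exact ⟨c, by rw [← hyl, ← hc]; rfl⟩

/-- A nonzero `σ`-stable ideal contains the idempotent of some factor, hence those of all factors,
because `σ` permutes them cyclically. -/
theorem IsSigmaAdmissible.isSimpleDifferenceRing (hσ : IsSigmaAdmissible F E σ) :
    IsSimpleDifferenceRing F σ := by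
  refine ⟨hσ.fixed, fun I hI => or_iff_not_imp_left.2 fun hne => ?_⟩
  obtain ⟨a, ha, ha0⟩ := (Submodule.ne_bot_iff I).1 hne
  obtain ⟨l, hl⟩ := Function.ne_iff.1 ha0
  have hstep : ∀ m : ZMod d, σ (Pi.single m 1) = Pi.single (m + 1) 1 := fun m => by
    obtain ⟨y, hy⟩ := hσ.map_component m 1
    have h : σ (Pi.single m 1) (m + 1) = σ 1 (m + 1) := by
      simpa using hσ.pow_apply_congr (k := 1) (l := m) (m := m + 1) (by simp)
        (y := Pi.single m 1) (z := 1) (by simp)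
    rw [hy, Pi.single_eq_same, map_one, Pi.one_apply] at h
    rw [hy, h]
  have hsingle : ∀ k : ℕ, (Pi.single (l + k) 1 : ∀ l, L l) ∈ I := fun k => by
    induction k with
    | zero =>
      have : (Pi.single (l + (0 : ℕ)) 1 : ∀ l, L l) = Pi.single l (a l)⁻¹ * a := by
        rw [Nat.cast_zero, add_zero]
        ext m
        by_cases h : m = l
        · subst h
          simp [inv_mul_cancel₀ hl]
        · simp [Pi.single_eq_of_ne h]
      rw [this]
      exact I.mul_mem_left _ ha
    | succ k ih =>
      have := hI _ ih
      rw [hstep] at this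
      rwa [Nat.cast_succ, ← add_assoc]
  rw [Ideal.eq_top_iff_one, ← Finset.univ_sum_single (1 : ∀ l, L l)]
  refine Ideal.sum_mem I fun m _ => ?_
  have := hsingle (m - l).val
  rw [ZMod.natCast_zmod_val, add_sub_cancel] at this
  exact this

theorem IsSigmaAdmissible.isSimpleSolution (hσ : IsSigmaAdmissible F E σ) {sE : E →+* E}
    (hE : ∀ x, σ (algebraMap E (∀ l, L l) x) = algebraMap E (∀ l, L l) (sE x))
    {Φ : GL (Fin r) E} {Ψ : GL (Fin r) (∀ l, L l)} (hΨ : IsFundamentalMatrix σ Φ Ψ) :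
    IsSimpleSolution F sE Φ σ Ψ where
  map_const x := (hσ.fixed _).2 ⟨x, rfl⟩
  map_base := hE
  map_matrix := hΨ
  isSimple := hσ.isSimpleDifferenceRing

theorem IsSigmaAdmissible.exists_isSimpleSolution_component (hσ : IsSigmaAdmissible F E σ)
    {sE : E →+* E}
    (hE : ∀ x, σ (algebraMap E (∀ l, L l) x) = algebraMap E (∀ l, L l) (sE x))
    {Φ : GL (Fin r) E} {Ψ : GL (Fin r) (∀ l, L l)}
    (hΨ : Matrix.GeneralLinearGroup.map (σ ^ d) Ψ =
      Matrix.GeneralLinearGroup.map (algebraMap E (∀ l, L l)) Φ * Ψ) (l : ZMod d) :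
    ∃ s : L l →+* L l, IsSimpleSolution F (sE ^ d) Φ s (component Ψ l) := by
  obtain ⟨s, hs⟩ := hσ.exists_component (l := l) (m := l) (k := d) (by simp)
  have h := hσ.isTwistedMap_component hs hE hΨ
  refine ⟨s, h, isSimpleDifferenceRing_of_field fun x => ⟨fun hx => ?_, ?_⟩⟩
  · refine hσ.mem_range_of_pow_fixed ?_
    rw [← hs, Pi.single_eq_same, hx]
  · rintro ⟨c, rfl⟩
    exact h.map_const c

variable [∀ l, IsScalarTower F E (L l)]

/-- All components of `Ψ` define the same group: powers of `σ` map the relations between the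
entries of `Ψ_l⁻¹ ⊗ Ψ_l` to those of any other component. -/
theorem IsSigmaAdmissible.quotientIdeal_component_eq (hσ : IsSigmaAdmissible F E σ)
    {Φ : GL (Fin r) E} {Ψ : GL (Fin r) (∀ l, L l)} (hΨ : IsFundamentalMatrix σ Φ Ψ)
    (l m : ZMod d) : quotientIdeal F E (component Ψ l) (component Ψ l) =
      quotientIdeal F E (component Ψ m) (component Ψ m) := by
  have key : ∀ l m : ZMod d, quotientIdeal F E (component Ψ l) (component Ψ l) ≤
      quotientIdeal F E (component Ψ m) (component Ψ m) := fun l m f hf => by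
    obtain ⟨sE, hE⟩ := hσ.exists_base
    obtain ⟨s, hs⟩ := hσ.exists_component (l := l) (m := m) (k := (m - l).val)
      (by rw [ZMod.natCast_zmod_val, add_sub_cancel])
    obtain ⟨Φ', hΦ'⟩ := exists_map_pow_eq hE hΨ (m - l).val
    have h := hσ.isTwistedMap_component hs hE hΦ'
    obtain ⟨τ, -, hτ⟩ := exists_map_tensorQuotient h h
    rw [RingHom.mem_ker, ← hτ]
    exact evalGL_mapGL_eq_zero τ hf
  exact le_antisymm (key l m) (key m l)

end Components

end FrobeniusTorsor

end

theorem mainTheorem7 {d : ℕ} [NeZero d] {F E : Type u} {L : ZMod d → Type v}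
    [Field F] [Field E] [∀ l, Field (L l)] [Algebra F E] [∀ l, Algebra E (L l)]
    [∀ l, Algebra F (L l)] [∀ l, IsScalarTower F E (L l)]
    (σ : (∀ l, L l) →+* (∀ l, L l)) (hσ : IsSigmaAdmissible F E σ)
    (r : ℕ) (hr : 0 < r) (Φ : GL (Fin r) E) (Ψ : GL (Fin r) (∀ l, L l))
    (hΨ : IsFundamentalMatrix σ Φ Ψ) :
    (∃ _ : GrpObj (closedSub (idealΓ F E Ψ)),
      IsClosedSubgroupScheme (closedSubι (idealΓ F E Ψ)) ∧
      IsRightTorsorIn (closedSubι (idealZ E Ψ) ≫ GLToBaseChange r F E)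
        ((baseChange F E).map (closedSubι (idealΓ F E Ψ)))) ∧
    (∃ _ : GrpObj (closedSub (idealΓComp F E Ψ 0)),
      IsClosedSubgroupScheme (closedSubι (idealΓComp F E Ψ 0)) ∧
      (∀ l : ZMod d, IsRightTorsorIn (closedSubι (idealZComp E Ψ l) ≫ GLToBaseChange r F E)
        ((baseChange F E).map (closedSubι (idealΓComp F E Ψ 0)))) ∧
      (∀ m : ZMod d,
        IsRightTorsorIn (closedSubι (idealΓComp F E Ψ m)) (closedSubι (idealΓComp F E Ψ 0)) ∧
        IsLeftTorsorIn (closedSubι (idealΓComp F E Ψ m)) (closedSubι (idealΓComp F E Ψ 0)))) := by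
  obtain ⟨sE, hE⟩ := hσ.exists_base
  obtain ⟨Φ', hΦ'⟩ := exists_map_pow_eq hE hΨ d
  have hL := hσ.isSimpleSolution hE hΨ
  have hcomp : ∀ l, ∃ s : L l →+* L l, IsSimpleSolution F (sE ^ d) Φ' s (component Ψ l) :=
    hσ.exists_isSimpleSolution_component hE hΦ'
  have hJ : ∀ l, idealΓComp F E Ψ 0 = quotientIdeal F E (component Ψ l) (component Ψ l) :=
    hσ.quotientIdeal_component_eq hΨ 0
  refine ⟨?_, ?_⟩
  · obtain ⟨inst, h⟩ := exists_isClosedSubgroupScheme_quotientIdeal hL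
    have : IsMonHom (closedSubι (quotientIdeal F E Ψ Ψ)) := h.isMonHom
    exact ⟨inst, h, isRightTorsorIn_ker_evalGL hL rfl⟩
  · obtain ⟨s₀, h₀⟩ := hcomp 0
    obtain ⟨inst, h⟩ : ∃ _ : GrpObj (closedSub (idealΓComp F E Ψ 0)),
        IsClosedSubgroupScheme (closedSubι (idealΓComp F E Ψ 0)) :=
      exists_isClosedSubgroupScheme_quotientIdeal h₀
    have : IsMonHom (closedSubι (idealΓComp F E Ψ 0)) := h.isMonHom
    refine ⟨inst, h, fun l => ?_, fun m => ?_⟩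
    · obtain ⟨s, hl⟩ := hcomp l
      exact isRightTorsorIn_ker_evalGL hl (hJ l)
    · obtain ⟨s, hm⟩ := hcomp m
      exact ⟨isRightTorsorIn_quotientIdeal h₀ hm (hJ m),
        isLeftTorsorIn_quotientIdeal h₀ hm (hJ 0)⟩
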